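/- Let $x\in\mathbb R^3$, let $u=(u^1,u^2,u^3)=(A,B,C)=\mathbf B$ be a vector field on $\mathbb R^3$, and write $u_1=(u^k_i)$, $u^k_i=\partial u^k/\partial x^i$, and $u^k_{ij}=\partial^2u^k/\partial x^i\partial x^j$. For a function $f(x,u,u_1)$ let $$D_if=\frac{\partial f}{\partial x^i}+\sum_k u^k_i\frac{\partial f}{\partial u^k}+\sum_{k,j}u^k_{ij}\frac{\partial f}{\partial u^k_j}$$ be its complete derivatives. For an infinitesimal operator $X=\sum_i\xi^i(x,u,u_1)\,\partial/\partial x^i+\sum_k\eta^k(x,u,u_1)\,\partial/\partial u^k$ with smooth coefficients on an open set $U$ of the space of first-order jets $(x,u,u_1)$, let $$X_1=X+\sum_{i,k}\xi^k_i\frac{\partial}{\partial u^k_i},\qquad \xi^k_i=D_i\eta^k-\sum_m u^k_m D_i\xi^m .$$ For a first-order system $\mathbf E(x,u,u_1)=0$ and a right-hand side $F$, the modified determining condition is $$X_1\mathbf E\,\big|_{\mathbf E=0}=F,$$ required at every second-order jet $(x,u,u_1,u_2)$ over $U$ that satisfies $\mathbf E=0$ and $D_i\mathbf E=0$ for $i=1,2,3$.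 Then the following hold for every open $U$. (a) (Vacuum fields to force-free fields.) Let $\mathbf E=(\operatorname{curl}\mathbf B,\ \operatorname{div}\mathbf B)$ and $F=(\alpha\mathbf B,\ 0)$, where $\alpha=\alpha(u,u_1)$ is smooth over $U$. If some smooth $X$ on $U$ satisfies the condition, then $\alpha(u,u_1)=0$ at every first-order jet $(x,u,u_1)\in U$ with $\operatorname{curl}\mathbf B=0$ and $\operatorname{div}\mathbf B=0$. Conversely, $\alpha\equiv0$ is admitted by some $X$. (b) (Force-free fields to plasma equilibria.) Let $\mathbf E=(\operatorname{curl}\mathbf B\times\mathbf B,\ \operatorname{div}\mathbf B)$ and $F=(\operatorname{grad}P,\ 0)$, where $P=P(x,u,u_1)$ is smooth on $U$ and $\operatorname{grad}P=(D_1P,D_2P,D_3P)$. If some smooth $X$ on $U$ satisfies the condition, then $P$ is constant on every connected set of first-order jets in $U$ that satisfy $\operatorname{curl}\mathbf B\times\mathbf B=0$ and $\operatorname{div}\mathbf B=0$; in particular, if $U$ is the whole jet space, then $P$ is a single constant on all such jets. Conversely, every constant $P$ is admitted by some $X$. -/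

import Mathlib

open scoped ContDiff Matrix

namespace PlasmaLie

/-- Vectors of `ℝ³`, in Cartesian coordinates. -/
abbrev Vec3 : Type := Fin 3 → ℝ

/-- Arrays of first derivatives: `p k i` stands for `∂u^k/∂x^i`. -/
abbrev Grad3 : Type := Fin 3 → Fin 3 → ℝ

/-- The space of first-order jets `(x, u, u₁)` of vector fields `u = (A, B, C)` on `ℝ³`:
`j.1` is the point `x`, `j.2.1` the field `u`, `j.2.2` the first derivatives `u₁`. -/
abbrev Jet1 : Type := Vec3 × Vec3 × Grad3

/-- Second-order jets: `h k i l` stands for `∂²u^k/∂x^i∂x^l`. -/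
structure Jet2 where
  base : Jet1
  h : Fin 3 → Fin 3 → Fin 3 → ℝ
  symm : ∀ k i l, h k i l = h k l i

section Operators

variable {W : Type*} [NormedAddCommGroup W] [NormedSpace ℝ W]

/-- The operator of complete differentiation
`D_i = ∂/∂x^i + ∑ u_i^k ∂/∂u^k + ∑ u_{ij}^k ∂/∂u_j^k` on functions `f(x, u, u₁)`. -/
noncomputable def totalDeriv (i : Fin 3) (f : Jet1 → W) (J : Jet2) : W :=
  fderiv ℝ f J.base
    (Pi.single i 1, fun k => J.base.2.2 k i, fun k l => J.h k l i)

/-- An infinitesimal operator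
`X = ∑ ξ^i(x,u,u₁) ∂/∂x^i + ∑ η^k(x,u,u₁) ∂/∂u^k`. -/
structure InfOp where
  ξ : Jet1 → Vec3
  η : Jet1 → Vec3

/-- The coefficients of `X` are smooth on `U`. -/
def InfOp.SmoothOn (X : InfOp) (U : Set Jet1) : Prop :=
  ContDiffOn ℝ ∞ X.ξ U ∧ ContDiffOn ℝ ∞ X.η U

/-- The coefficients `ξ_i^k = D_i η^k - ∑_m u_m^k D_i ξ^m` of the prolonged operator. -/
noncomputable def InfOp.prolongCoeff (X : InfOp) (J : Jet2) : Grad3 := fun k i =>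
  totalDeriv i (fun j => X.η j k) J -
    ∑ m, J.base.2.2 k m * totalDeriv i (fun j => X.ξ j m) J

/-- The prolonged operator
`X₁ = ∑ ξ^i ∂/∂x^i + ∑ η^k ∂/∂u^k + ∑ ξ_i^k ∂/∂u_i^k` applied to `E(x, u, u₁)`. -/
noncomputable def InfOp.prolong (X : InfOp) (E : Jet1 → W) (J : Jet2) : W :=
  fderiv ℝ E J.base (X.ξ J.base, X.η J.base, X.prolongCoeff J)

/-- The second-order jet `J` satisfies the system `E = 0` and its first differential
consequences `D_i E = 0`. -/
def OnSystem (E : Jet1 → W) (J : Jet2) : Prop :=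
  E J.base = 0 ∧ ∀ i, totalDeriv i E J = 0

/-- The modified determining condition `X₁ E |_{E = 0} = F`, over the part of the equation
manifold that lies above `U`. -/
def ModifiedDetermining (U : Set Jet1) (E : Jet1 → W) (F : Jet2 → W) (X : InfOp) : Prop :=
  ∀ J : Jet2, J.base ∈ U → OnSystem E J → X.prolong E J = F J

end Operators

/-- The components of `curl u` in terms of the first derivatives. -/
def curlJet (p : Grad3) : Vec3 :=
  ![p 2 1 - p 1 2, p 0 2 - p 2 0, p 1 0 - p 0 1]

/-- `div u` in terms of the first derivatives. -/
def divJet (p : Grad3) : ℝ := ∑ i, p i i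

/-- Vacuum magnetic fields: `curl B = 0`, `div B = 0`. -/
def vacuumSys (j : Jet1) : Vec3 × ℝ := (curlJet j.2.2, divJet j.2.2)

/-- Force-free fields: `curl B × B = 0`, `div B = 0`. -/
def forceFreeSys (j : Jet1) : Vec3 × ℝ :=
  (crossProduct (curlJet j.2.2) j.2.1, divJet j.2.2)

/-- Right-hand sides of the system `curl B = α(u, u₁) B`, `div B = 0`. -/
def forceFreeRhs (α : Vec3 → Grad3 → ℝ) (J : Jet2) : Vec3 × ℝ :=
  (α J.base.2.1 J.base.2.2 • J.base.2.1, 0)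

/-- Right-hand sides of the system `curl B × B = grad P`, `div B = 0` with `P = P(x, u, u₁)`;
the gradient along a field is formed with the complete derivatives `D_i P`. -/
noncomputable def plasmaRhs (P : Jet1 → ℝ) (J : Jet2) : Vec3 × ℝ :=
  (fun i => totalDeriv i P J, 0)

/-- `α` is admissible over `U`: some smooth infinitesimal operator takes vacuum fields to
force-free fields with factor `α`, in the sense of the modified determining condition. -/
def AdmissibleAlpha (U : Set Jet1) (α : Vec3 → Grad3 → ℝ) : Prop :=
  ∃ X : InfOp, X.SmoothOn U ∧ ModifiedDetermining U vacuumSys (forceFreeRhs α) X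

/-- `P` is admissible over `U`: some smooth infinitesimal operator takes force-free fields to
plasma equilibria with pressure `P`, in the sense of the modified determining condition. -/
def AdmissiblePressure (U : Set Jet1) (P : Jet1 → ℝ) : Prop :=
  ∃ X : InfOp, X.SmoothOn U ∧ ModifiedDetermining U forceFreeSys (plasmaRhs P) X

end PlasmaLie

open PlasmaLie

namespace PlasmaLie

/-! ### Calculus lemmas -/

/-! Only the characteristic Q = η - u₁ξ matters: on the equation manifold the remaining part of X₁E
is ∑ ξ^m D_m E = 0, so the determining condition says that the linearised system, applied to the
complete derivatives of Q, equals F. Every free coordinate of the second-order jet can then be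
varied separately. The converses are given by X = 0.

Both parts begin by varying the harmonic part of u₂ (symmetric, all traces zero). The derivative of
Q in the symmetric traceless part s of u₁ is a map from spin 2 to spin 1, and 2 ⊗ 1 = 3 + 2 + 1. The
divergence condition kills the spin 3 component and the curl condition the spin 2 component
(`exists_eq_stf_mulVec`). Equality of mixed derivatives then makes Q = u₁ v + w with v, w
independent of s (`exists_eq_mv_stf_add`), so that the condition becomes quadratic in s.

(a) Where u ≠ 0, the quadratic coefficients give ∂v/∂u = 0. The linear ones make ∂v/∂x and ∂w/∂u
conformal with opposite off-diagonal entries, and the constant one is curl_x w = αu. Hence w is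
affine in u, and so is curl_x w. A field affine in u, everywhere parallel to u, whose linear part
has trace zero, vanishes (`curlX_eq_zero`). Points with u = 0 follow by continuity.

(b) Where u ≠ 0, a force-free jet has curl u = λu, and μ = grad λ is arbitrary subject to μ·u = 0.
The scalar product of the first equation with u gives u·grad P = 0, which makes P a function p(λ)
(`pressure_depends_on_factor`). Varying μ gives ∂v/∂λ = 0 and ∂w/∂λ = -p'(λ) u/|u|²
(`factor_derivative`). Comparing the divergence condition at two values of λ yields Δλ b + 2 Δp
u/|u|⁴ = 0, where b, the axial vector of ∂v/∂u, does not depend on u. The second term has degree -3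
in u, so rescaling u forces Δp = 0 (`pressure_eq_of_reduced`). The set u = 0, where the variety is
singular, is reached by limits of tangent directions (`fderiv_pressure_singular`), so P is locally
constant on the whole variety. That variety is star-shaped about 0, hence connected. -/

theorem eq_of_fderiv_apply_sub_eq_zero {E F : Type*} [NormedAddCommGroup E] [NormedSpace ℝ E]
    [NormedAddCommGroup F] [NormedSpace ℝ F] {f : E → F} {B : Set E} (hB : Convex ℝ B)
    (hf : ∀ z ∈ B, DifferentiableAt ℝ f z) {a b : E} (ha : a ∈ B) (hb : b ∈ B)
    (h : ∀ z ∈ B, fderiv ℝ f z (b - a) = 0) : f a = f b := by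
  have hmem : ∀ t ∈ Set.Icc (0 : ℝ) 1, a + t • (b - a) ∈ B := fun t ht =>
    hB.add_smul_sub_mem ha hb ht
  have hd : ∀ t ∈ Set.Icc (0 : ℝ) 1, HasDerivAt (fun t : ℝ => f (a + t • (b - a))) 0 t := by
    intro t ht
    have h1 : HasDerivAt (fun t : ℝ => a + t • (b - a)) (b - a) t := by
      simpa using ((hasDerivAt_id t).smul_const (b - a)).const_add a
    have h2 := (hf _ (hmem t ht)).hasFDerivAt.comp_hasDerivAt t h1
    rw [h _ (hmem t ht)] at h2
    exact h2
  have := constant_of_has_deriv_right_zero (f := fun t : ℝ => f (a + t • (b - a)))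
    (fun t ht => (hd t ht).continuousAt.continuousWithinAt)
    (fun t ht => (hd t ⟨ht.1, ht.2.le⟩).hasDerivWithinAt) 1 (by simp)
  simpa using this.symm

theorem fderiv_fderiv_apply_comm {E F : Type*} [NormedAddCommGroup E] [NormedSpace ℝ E]
    [NormedAddCommGroup F] [NormedSpace ℝ F] {f : E → F} {z : E} (hf : ContDiffAt ℝ ∞ f z)
    (a b : E) :
    fderiv ℝ (fun y => fderiv ℝ f y a) z b = fderiv ℝ (fun y => fderiv ℝ f y b) z a := by
  have hs : IsSymmSndFDerivAt ℝ f z := hf.isSymmSndFDerivAt (by simp only [minSmoothness_of_isRCLikeNormedField]; exact WithTop.coe_le_coe.2 le_top)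
  have hd : DifferentiableAt ℝ (fderiv ℝ f) z :=
    (hf.fderiv_right (m := ∞) (by simp)).differentiableAt (by simp)
  have key : ∀ c d : E, fderiv ℝ (fun y => fderiv ℝ f y c) z d = fderiv ℝ (fderiv ℝ f) z d c := by
    intro c d
    have := (hd.hasFDerivAt.clm_apply (hasFDerivAt_const c z)).fderiv
    rw [this]; simp
  rw [key, key]
  exact hs b a

theorem contDiffAt_fderiv_apply {E F : Type*} [NormedAddCommGroup E] [NormedSpace ℝ E]
    [NormedAddCommGroup F] [NormedSpace ℝ F] {f : E → F} {z : E} (hf : ContDiffAt ℝ ∞ f z)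
    (a : E) : ContDiffAt ℝ ∞ (fun y => fderiv ℝ f y a) z :=
  (hf.fderiv_right (m := ∞) (by simp)).clm_apply contDiffAt_const

theorem quadratic_coeff_eq_zero {a b c ε : ℝ} (hε : 0 < ε)
    (h : ∀ t : ℝ, |t| < ε → a + b * t + c * t ^ 2 = 0) : a = 0 ∧ b = 0 ∧ c = 0 := by
  have h0 := h 0 (by simpa using hε)
  have h1 := h (ε / 2) (by rw [abs_of_pos (by linarith)]; linarith)
  have h2 := h (-(ε / 2)) (by rw [abs_neg, abs_of_pos (by linarith)]; linarith)
  have ha : a = 0 := by linarith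
  have hb : b * ε = 0 := by linarith
  have hc : c * ε ^ 2 = 0 := by nlinarith
  have hε' := hε.ne'
  exact ⟨ha, by simpa [hε'] using hb, by simpa [hε'] using hc⟩

/-! ### Algebra of symmetric traceless tensors -/

/-- The symmetric traceless matrix with given coordinates. -/
noncomputable def stf : (Fin 5 → ℝ) →L[ℝ] Grad3 := LinearMap.toContinuousLinearMap
  { toFun := fun s => ![![s 0, s 2, s 3], ![s 2, s 1, s 4], ![s 3, s 4, -s 0 - s 1]]
    map_add' := by
      intro s t; ext i j; fin_cases i <;> fin_cases j <;> simp; ring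
    map_smul' := by
      intro c s; ext i j; fin_cases i <;> fin_cases j <;> simp; ring }

/-- The antisymmetric matrix with curl `2c`, that is, `v ↦ c × v`. -/
noncomputable def rot : Vec3 →L[ℝ] Grad3 := LinearMap.toContinuousLinearMap
  { toFun := fun c => ![![0, -c 2, c 1], ![c 2, 0, -c 0], ![-c 1, c 0, 0]]
    map_add' := by
      intro s t; ext i j; fin_cases i <;> fin_cases j <;> simp <;> ring
    map_smul' := by
      intro c s; ext i j; fin_cases i <;> fin_cases j <;> simp }

/-- Coordinates of the symmetric traceless part. -/
noncomputable def stfCoord (p : Grad3) : Fin 5 → ℝ :=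
  ![p 0 0, p 1 1, (p 0 1 + p 1 0) / 2, (p 0 2 + p 2 0) / 2, (p 1 2 + p 2 1) / 2]

/-- The symmetric third-order tensors with vanishing traces. -/
def harm (t : Fin 7 → ℝ) : Fin 3 → Grad3 :=
  ![![![-t 3 - t 5, t 0, t 1], ![t 0, t 3, t 2], ![t 1, t 2, t 5]],
    ![![t 0, t 3, t 2], ![t 3, -t 0 - t 6, t 4], ![t 2, t 4, t 6]],
    ![![t 1, t 2, t 5], ![t 2, t 4, t 6], ![t 5, t 6, -t 1 - t 4]]]

theorem stf_eq (s : Fin 5 → ℝ) :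
    stf s = ![![s 0, s 2, s 3], ![s 2, s 1, s 4], ![s 3, s 4, -s 0 - s 1]] := rfl

theorem rot_eq (c : Vec3) :
    rot c = ![![0, -c 2, c 1], ![c 2, 0, -c 0], ![-c 1, c 0, 0]] := rfl

theorem eq_stf_add_rot {p : Grad3} (hp : divJet p = 0) :
    p = stf (stfCoord p) + (1 / 2 : ℝ) • rot (curlJet p) := by
  simp only [divJet, Fin.sum_univ_three] at hp
  ext i j
  fin_cases i <;> fin_cases j <;> simp [stf_eq, rot_eq, stfCoord, curlJet] <;> linarith

theorem divJet_stf_add_rot (s : Fin 5 → ℝ) (c : Vec3) : divJet (stf s + rot c) = 0 := by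
  simp [divJet, Fin.sum_univ_three, stf_eq, rot_eq]

theorem curlJet_stf_add_rot (s : Fin 5 → ℝ) (c : Vec3) :
    curlJet (stf s + rot c) = (2 : ℝ) • c := by
  ext i; fin_cases i <;> simp [curlJet, stf_eq, rot_eq] <;> ring

theorem vec_eq_zero_of_sq {u : Vec3} (h : u 0 ^ 2 + u 1 ^ 2 + u 2 ^ 2 = 0) : u = 0 := by
  have h0 : u 0 = 0 := by nlinarith [sq_nonneg (u 0), sq_nonneg (u 1), sq_nonneg (u 2)]
  have h1 : u 1 = 0 := by nlinarith [sq_nonneg (u 0), sq_nonneg (u 1), sq_nonneg (u 2)]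
  have h2 : u 2 = 0 := by nlinarith [sq_nonneg (u 0), sq_nonneg (u 1), sq_nonneg (u 2)]
  ext i; fin_cases i <;> assumption

theorem sq_pos_of_ne_zero {u : Vec3} (h : u ≠ 0) : 0 < u 0 ^ 2 + u 1 ^ 2 + u 2 ^ 2 :=
  lt_of_le_of_ne (by positivity) fun h' => h (vec_eq_zero_of_sq h'.symm)

/-- A second-order spherical tensor whose product with a nonzero vector has no harmonic part
vanishes. -/
theorem eq_zero_of_harm_contract {π : Fin 5 → ℝ} {u : Vec3} (hu : u ≠ 0)
    (h : ∀ t, ∑ i, u i * ∑ a, π a * stfCoord (fun k l => harm t k l i) a = 0) : π = 0 := by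
  have hu' := sq_pos_of_ne_zero hu
  obtain ⟨a, ha⟩ : ∃ a, a = (2 * π 0 - π 1) / 3 := ⟨_, rfl⟩
  obtain ⟨b, hb⟩ : ∃ b, b = (2 * π 1 - π 0) / 3 := ⟨_, rfl⟩
  obtain ⟨c, hc⟩ : ∃ c, c = π 2 / 2 := ⟨_, rfl⟩
  obtain ⟨d, hd⟩ : ∃ d, d = π 3 / 2 := ⟨_, rfl⟩
  obtain ⟨e, he⟩ : ∃ e, e = π 4 / 2 := ⟨_, rfl⟩
  have h0 : π 0 = 2 * a + b := by linarith
  have h1 : π 1 = a + 2 * b := by linarith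
  have h2 : π 2 = 2 * c := by linarith
  have h3 : π 3 = 2 * d := by linarith
  have h4 : π 4 = 2 * e := by linarith
  obtain ⟨x, hx⟩ : ∃ x, x = a * u 0 + c * u 1 + d * u 2 := ⟨_, rfl⟩
  obtain ⟨y, hy⟩ : ∃ y, y = c * u 0 + b * u 1 + e * u 2 := ⟨_, rfl⟩
  obtain ⟨z, hz⟩ : ∃ z, z = d * u 0 + e * u 1 - (a + b) * u 2 := ⟨_, rfl⟩
  -- Let Π be the symmetric traceless matrix with entries a, b, c, d, e that represents π in the
  -- Frobenius product. The test tensor is the harmonic projection H of the symmetrised u ⊗ Π; 2/15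
  -- is the trace correction, with (x, y, z) = Πu. The contraction then equals |H|² = |Π|²|u|²/3 +
  -- 2|Πu|²/5.
  have key := h ![(a * u 1 + 2 * c * u 0) / 3 - 2 / 15 * y,
    (a * u 2 + 2 * d * u 0) / 3 - 2 / 15 * z,
    (c * u 2 + e * u 0 + d * u 1) / 3,
    (b * u 0 + 2 * c * u 1) / 3 - 2 / 15 * x,
    (b * u 2 + 2 * e * u 1) / 3 - 2 / 15 * z,
    (-(a + b) * u 0 + 2 * d * u 2) / 3 - 2 / 15 * x,
    (-(a + b) * u 1 + 2 * e * u 2) / 3 - 2 / 15 * y]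
  simp [Fin.sum_univ_succ, harm, stfCoord] at key
  have hq : (a ^ 2 + b ^ 2 + (a + b) ^ 2 + 2 * c ^ 2 + 2 * d ^ 2 + 2 * e ^ 2) *
      (u 0 ^ 2 + u 1 ^ 2 + u 2 ^ 2) / 3 + 2 / 5 * (x ^ 2 + y ^ 2 + z ^ 2) = 0 := by
    rw [← key]
    simp only [h0, h1, h2, h3, h4, hx, hy, hz]
    ring
  have hn : a ^ 2 + b ^ 2 + (a + b) ^ 2 + 2 * c ^ 2 + 2 * d ^ 2 + 2 * e ^ 2 = 0 := by
    have h1' : 0 ≤ a ^ 2 + b ^ 2 + (a + b) ^ 2 + 2 * c ^ 2 + 2 * d ^ 2 + 2 * e ^ 2 := by positivity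
    have h2' : 0 ≤ x ^ 2 + y ^ 2 + z ^ 2 := by positivity
    have := mul_nonneg h1' hu'.le
    have h3' : (a ^ 2 + b ^ 2 + (a + b) ^ 2 + 2 * c ^ 2 + 2 * d ^ 2 + 2 * e ^ 2) *
      (u 0 ^ 2 + u 1 ^ 2 + u 2 ^ 2) = 0 := by linarith
    rcases mul_eq_zero.1 h3' with h | h
    · exact h
    · exact absurd h hu'.ne'
  have qa := sq_nonneg a
  have qb := sq_nonneg b
  have qab := sq_nonneg (a + b)
  have qc := sq_nonneg c
  have qd := sq_nonneg d
  have qe := sq_nonneg e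
  have ha0 : a = 0 := sq_eq_zero_iff.1 <| le_antisymm (by linarith) qa
  have hb0 : b = 0 := sq_eq_zero_iff.1 <| le_antisymm (by linarith) qb
  have hc0 : c = 0 := sq_eq_zero_iff.1 <| le_antisymm (by linarith) qc
  have hd0 : d = 0 := sq_eq_zero_iff.1 <| le_antisymm (by linarith) qd
  have he0 : e = 0 := sq_eq_zero_iff.1 <| le_antisymm (by linarith) qe
  ext i; fin_cases i <;> simp [h0, h1, h2, h3, h4, ha0, hb0, hc0, hd0, he0]

theorem stf_mulVec_eq (s : Fin 5 → ℝ) (v : Vec3) : Matrix.mulVec (stf s) v =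
    ![s 0 * v 0 + s 2 * v 1 + s 3 * v 2, s 2 * v 0 + s 1 * v 1 + s 4 * v 2,
      s 3 * v 0 + s 4 * v 1 + (-s 0 - s 1) * v 2] := by
  ext i; fin_cases i <;> simp [Matrix.mulVec, dotProduct, Fin.sum_univ_three, stf_eq]

/-- A linear map from symmetric traceless matrices to vectors whose contractions with harmonic
tensors have no trace, and no curl along `n ≠ 0`, is evaluation at a vector. -/
theorem exists_eq_stf_mulVec (M : (Fin 5 → ℝ) →ₗ[ℝ] Vec3) {n : Vec3} (hn : n ≠ 0)
    (htr : ∀ t, ∑ k, M (stfCoord fun a b => harm t a b k) k = 0)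
    (hcurl : ∀ t, ∑ i, n i * curlJet (fun k i => M (stfCoord fun a b => harm t a b i) k) i = 0) :
    ∀ s, M s = Matrix.mulVec (stf s)
      ![(M (Pi.single 2 1) 1 + M (Pi.single 3 1) 2) / 2,
        (M (Pi.single 2 1) 0 + M (Pi.single 4 1) 2) / 2,
        (M (Pi.single 3 1) 0 + M (Pi.single 4 1) 1) / 2] := by
  obtain ⟨m, hm⟩ : ∃ m : Fin 5 → Vec3, ∀ a, M (Pi.single a 1) = m a := ⟨_, fun a => rfl⟩
  have hM : ∀ s k, M s k = s 0 * m 0 k + s 1 * m 1 k + s 2 * m 2 k + s 3 * m 3 k + s 4 * m 4 k := by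
    intro s k
    rw [LinearMap.pi_apply_eq_sum_univ M s]
    have : ∀ i : Fin 5, (fun j => if i = j then (1 : ℝ) else 0) = Pi.single i 1 := by
      intro i; ext j; simp [Pi.single_apply, eq_comm]
    simp [this, hm, Fin.sum_univ_five]
  simp only [hM, stfCoord, Fin.sum_univ_three, curlJet] at htr hcurl
  have e (i : Fin 7) := htr (Pi.single i 1)
  have e0 := e 0
  have e1 := e 1
  have e2 := e 2
  have e3 := e 3
  have e4 := e 4
  have e5 := e 5
  have e6 := e 6
  simp [harm] at e0 e1 e2 e3 e4 e5 e6
  clear e htr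
  -- The seven trace equations remove the spin 3 part and leave 15 - 7 = 8 parameters: a, b, c, d, f
  -- for spin 2 and v0, v1, v2 for spin 1.
  obtain ⟨a, ha⟩ : ∃ a, a = (m 3 1 - m 2 2) / 3 := ⟨_, rfl⟩
  obtain ⟨b, hb⟩ : ∃ b, b = a + m 2 2 := ⟨_, rfl⟩
  obtain ⟨c, hc⟩ : ∃ c, c = (m 4 1 - m 3 0) / 2 := ⟨_, rfl⟩
  obtain ⟨d, hd⟩ : ∃ d, d = (m 2 0 - m 4 2) / 2 := ⟨_, rfl⟩
  obtain ⟨f, hf⟩ : ∃ f, f = (m 3 2 - m 2 1) / 2 := ⟨_, rfl⟩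
  obtain ⟨v0, hv0⟩ : ∃ v, v = (m 2 1 + m 3 2) / 2 := ⟨_, rfl⟩
  obtain ⟨v1, hv1⟩ : ∃ v, v = (m 2 0 + m 4 2) / 2 := ⟨_, rfl⟩
  obtain ⟨v2, hv2⟩ : ∃ v, v = (m 3 0 + m 4 1) / 2 := ⟨_, rfl⟩
  have m00 : m 0 0 = v0 + f := by linarith
  have m01 : m 0 1 = -2 * d := by linarith
  have m02 : m 0 2 = c - v2 := by linarith
  have m10 : m 1 0 = 2 * f := by linarith
  have m11 : m 1 1 = v1 - d := by linarith
  have m12 : m 1 2 = -v2 - c := by linarith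
  have m20 : m 2 0 = v1 + d := by linarith
  have m21 : m 2 1 = v0 - f := by linarith
  have m22 : m 2 2 = b - a := by linarith
  have m30 : m 3 0 = v2 - c := by linarith
  have m31 : m 3 1 = 2 * a + b := by linarith
  have m32 : m 3 2 = v0 + f := by linarith
  have m40 : m 4 0 = -a - 2 * b := by linarith
  have m41 : m 4 1 = v2 + c := by linarith
  have m42 : m 4 2 = v1 - d := by linarith
  clear ha hb hc hd hf hv0 hv1 hv2 e0 e1 e2 e3 e4 e5 e6
  -- The spin 1 part contributes no curl, so the curl hypothesis is the harmonic contraction of the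
  -- spin 2 part with n.
  have hz : (![2 * a + b, a + 2 * b, 2 * c, 2 * d, 2 * f] : Fin 5 → ℝ) = 0 := by
    refine eq_zero_of_harm_contract hn fun t => ?_
    have := hcurl t
    simp [harm, m00, m01, m02, m10, m11, m12, m20, m21, m22, m30, m31, m32, m40, m41, m42] at this
    simp [Fin.sum_univ_five, Fin.sum_univ_three, harm, stfCoord]
    linear_combination this
  have z0 := congrFun hz 0
  have z1 := congrFun hz 1
  have z2 := congrFun hz 2
  have z3 := congrFun hz 3
  have z4 := congrFun hz 4
  simp at z0 z1 z2 z3 z4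
  have ha : a = 0 := by linarith
  have hb : b = 0 := by linarith
  intro s
  rw [stf_mulVec_eq]
  ext k
  rw [hM]
  fin_cases k <;> simp [hm, m00, m01, m02, m10, m11, m12, m20, m21, m22, m30, m31, m32, m40, m41,
    m42, ha, hb, z2, z3, z4] <;> ring

/-- The product of a matrix and a vector as a continuous bilinear map. -/
noncomputable def mv : Grad3 →L[ℝ] Vec3 →L[ℝ] Vec3 :=
  LinearMap.toContinuousBilinearMap
    (LinearMap.mk₂ ℝ (fun (p : Grad3) (v : Vec3) => Matrix.mulVec p v)
      (fun p q v => Matrix.add_mulVec p q v) (fun c p v => Matrix.smul_mulVec c p v)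
      (fun p v w => Matrix.mulVec_add p v w) (fun c p v => Matrix.mulVec_smul p c v))

theorem mv_eq (p : Grad3) (v : Vec3) : mv p v = Matrix.mulVec p v := rfl

theorem mv_apply (p : Grad3) (v : Vec3) (k : Fin 3) :
    mv p v k = p k 0 * v 0 + p k 1 * v 1 + p k 2 * v 2 := by
  simp [mv_eq, Matrix.mulVec, dotProduct, Fin.sum_univ_three]

/-- The space of maps s ↦ `stf s` v has zero first prolongation, as comparison of pairs of basis
vectors shows. With L the s-derivative of the coefficient V in ∂Q/∂s = `stf` V, the symmetry is that
of second derivatives, and the conclusion makes V independent of s. -/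
theorem eq_zero_of_stf_mulVec_symm (L : (Fin 5 → ℝ) →ₗ[ℝ] Vec3)
    (h : ∀ r s, mv (stf s) (L r) = mv (stf r) (L s)) : L = 0 := by
  obtain ⟨m, hm⟩ : ∃ m : Fin 5 → Vec3, ∀ a, L (Pi.single a 1) = m a := ⟨_, fun a => rfl⟩
  have hm0 : ∀ a, m a = 0 := by
    have e (a b : Fin 5) (k : Fin 3) := congrFun (h (Pi.single a 1) (Pi.single b 1)) k
    simp only [hm, mv_apply] at e
    have e01 := e 0 1
    have e02 := e 0 2
    have e03 := e 0 3
    have e04 := e 0 4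
    have e12 := e 1 2
    have e13 := e 1 3
    have e14 := e 1 4
    have e23 := e 2 3
    have e24 := e 2 4
    have e34 := e 3 4
    simp only [Fin.forall_fin_succ, stf_eq] at e01 e02 e03 e04 e12 e13 e14 e23 e24 e34
    simp at e01 e02 e03 e04 e12 e13 e14 e23 e24 e34
    intro a
    ext k
    fin_cases a <;> fin_cases k <;> simp <;> grind
  refine LinearMap.pi_ext' fun a => LinearMap.ext_ring ?_
  simp [hm, hm0]

/-! ### Integration to characteristics affine in the first derivatives -/

/-- A map into vectors whose derivative along the symmetric traceless variable satisfies the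
harmonic contraction conditions is affine in that variable. -/
theorem exists_eq_mv_stf_add {Y : Type*} [NormedAddCommGroup Y] [NormedSpace ℝ Y]
    {Q : Y × (Fin 5 → ℝ) → Vec3} {y₀ : Y} {s₀ : Fin 5 → ℝ} {r : ℝ}
    (hQ : ∀ z ∈ Metric.ball (y₀, s₀) r, ContDiffAt ℝ ∞ Q z)
    (h : ∀ z ∈ Metric.ball (y₀, s₀) r, ∃ n : Vec3, n ≠ 0 ∧
      (∀ t, ∑ k, fderiv ℝ Q z (0, stfCoord fun a b => harm t a b k) k = 0) ∧
      ∀ t, ∑ i, n i *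
        curlJet (fun k i => fderiv ℝ Q z (0, stfCoord fun a b => harm t a b i) k) i = 0) :
    ∃ v w : Y → Vec3, (∀ y ∈ Metric.ball y₀ r, ContDiffAt ℝ ∞ v y) ∧
      (∀ y ∈ Metric.ball y₀ r, ContDiffAt ℝ ∞ w y) ∧
      ∀ y ∈ Metric.ball y₀ r, ∀ s ∈ Metric.ball s₀ r, Q (y, s) = mv (stf s) (v y) + w y := by
  obtain ⟨D, hD⟩ : ∃ D : Fin 5 → Y × (Fin 5 → ℝ) → Vec3,
    ∀ a, D a = fun z => fderiv ℝ Q z (0, Pi.single a 1) := ⟨_, fun a => rfl⟩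
  have hDs : ∀ a, ∀ z ∈ Metric.ball (y₀, s₀) r, ContDiffAt ℝ ∞ (D a) z := fun a z hz => by
    rw [hD]; exact contDiffAt_fderiv_apply (hQ z hz) _
  obtain ⟨V, hV⟩ : ∃ V : Y × (Fin 5 → ℝ) → Vec3, V = fun z =>
    ![(D 2 z 1 + D 3 z 2) / 2, (D 2 z 0 + D 4 z 2) / 2, (D 3 z 0 + D 4 z 1) / 2] := ⟨_, rfl⟩
  have hVs : ∀ z ∈ Metric.ball (y₀, s₀) r, ContDiffAt ℝ ∞ V z := fun z hz => by
    have hc : ∀ a k, ContDiffAt ℝ ∞ (fun z => D a z k) z := fun a k =>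
      contDiffAt_pi.1 (hDs a z hz) k
    rw [hV]
    refine contDiffAt_pi.2 fun k => ?_
    fin_cases k
    · exact ((hc 2 1).add (hc 3 2)).div_const 2
    · exact ((hc 2 0).add (hc 4 2)).div_const 2
    · exact ((hc 3 0).add (hc 4 1)).div_const 2
  have hQV : ∀ z ∈ Metric.ball (y₀, s₀) r, ∀ s, fderiv ℝ Q z (0, s) = mv (stf s) (V z) := by
    intro z hz s
    obtain ⟨n, hn, htr, hcurl⟩ := h z hz
    have := exists_eq_stf_mulVec
      ((fderiv ℝ Q z).toLinearMap ∘ₗ LinearMap.inr ℝ Y (Fin 5 → ℝ)) hn htr hcurl s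
    simp only [LinearMap.comp_apply, LinearMap.inr_apply, ContinuousLinearMap.coe_coe] at this
    rw [this, hV, mv_eq]
    simp [hD]
  have hV0 : ∀ z ∈ Metric.ball (y₀, s₀) r, ∀ s, fderiv ℝ V z (0, s) = 0 := by
    intro z hz
    have hmul : ∀ s b, fderiv ℝ (fun z => fderiv ℝ Q z (0, s)) z b =
        mv (stf s) (fderiv ℝ V z b) := by
      intro s b
      have he : (fun z => fderiv ℝ Q z (0, s)) =ᶠ[nhds z] fun z => mv (stf s) (V z) := by
        filter_upwards [Metric.isOpen_ball.mem_nhds hz] with z' hz'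
        exact hQV z' hz' s
      rw [he.fderiv_eq]
      have := ((mv (stf s)).hasFDerivAt.comp z
        ((hVs z hz).differentiableAt (by simp)).hasFDerivAt).fderiv
      rw [Function.comp_def] at this
      rw [this]; rfl
    have := eq_zero_of_stf_mulVec_symm
      ((fderiv ℝ V z).toLinearMap ∘ₗ LinearMap.inr ℝ Y (Fin 5 → ℝ)) (by
        intro a b
        simp only [LinearMap.comp_apply, LinearMap.inr_apply, ContinuousLinearMap.coe_coe]
        rw [← hmul, ← hmul]
        exact fderiv_fderiv_apply_comm (hQ z hz) _ _)
    intro s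
    exact LinearMap.congr_fun this s
  have hin : ∀ y : Y, ContDiffAt ℝ ∞ (fun y : Y => (y, s₀)) y := fun y =>
    contDiffAt_id.prodMk contDiffAt_const
  have hmem : ∀ y ∈ Metric.ball y₀ r, ∀ s ∈ Metric.ball s₀ r, (y, s) ∈ Metric.ball (y₀, s₀) r := by
    intro y hy s hs
    rw [← ball_prod_same]; exact ⟨hy, hs⟩
  have hs₀ : ∀ y ∈ Metric.ball y₀ r, s₀ ∈ Metric.ball s₀ r := fun y hy =>
    Metric.mem_ball_self (dist_nonneg.trans_lt hy)
  have hvs : ∀ y ∈ Metric.ball y₀ r, ContDiffAt ℝ ∞ (fun y => V (y, s₀)) y := fun y hy =>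
    (hVs _ (hmem y hy s₀ (hs₀ y hy))).comp y (hin y)
  refine ⟨fun y => V (y, s₀), fun y => Q (y, s₀) - mv (stf s₀) (V (y, s₀)), hvs, ?_, ?_⟩
  · intro y hy
    exact ((hQ _ (hmem y hy s₀ (hs₀ y hy))).comp y (hin y)).sub
      ((mv (stf s₀)).contDiff.contDiffAt.comp y (hvs y hy))
  · intro y hy s hs
    have hVc : ∀ s ∈ Metric.ball s₀ r, V (y, s) = V (y, s₀) := fun s hs =>
      eq_of_fderiv_apply_sub_eq_zero (convex_ball _ _)
        (fun z hz => (hVs z hz).differentiableAt (by simp)) (hmem y hy s hs)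
        (hmem y hy s₀ (hs₀ y hy)) (fun z hz => by simpa using hV0 z hz (s₀ - s))
    have hd : ∀ z ∈ Metric.ball s₀ r, HasFDerivAt (fun s => Q (y, s) - mv (stf s) (V (y, s₀)))
        (0 : (Fin 5 → ℝ) →L[ℝ] Vec3) z := by
      intro z hz
      have h1 : HasFDerivAt (fun s : Fin 5 → ℝ => (y, s)) (ContinuousLinearMap.inr ℝ Y _) z :=
        hasFDerivAt_prodMk_right y z
      have h2 := ((hQ _ (hmem y hy z hz)).differentiableAt (by simp)).hasFDerivAt.comp z h1
      have h3 := (((mv.flip (V (y, s₀))).comp stf).hasFDerivAt (x := z))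
      refine (h2.sub h3).congr_fderiv ?_
      ext1 s
      simp [hQV _ (hmem y hy z hz), hVc z hz]
    have := eq_of_fderiv_apply_sub_eq_zero (f := fun s => Q (y, s) - mv (stf s) (V (y, s₀)))
      (convex_ball s₀ r) (fun z hz => (hd z hz).differentiableAt) hs (hs₀ y hy)
      (fun z hz => by rw [(hd z hz).fderiv]; rfl)
    exact sub_eq_iff_eq_add'.1 this

/-! ### Linearised systems and the characteristic -/

/-- The curl as a continuous linear map. -/
noncomputable def curlL : Grad3 →L[ℝ] Vec3 := LinearMap.toContinuousLinearMap
  { toFun := curlJet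
    map_add' := by intro p q; ext i; fin_cases i <;> simp [curlJet] <;> ring
    map_smul' := by intro c p; ext i; fin_cases i <;> simp [curlJet] <;> ring }

/-- The divergence as a continuous linear map. -/
noncomputable def divL : Grad3 →L[ℝ] ℝ := LinearMap.toContinuousLinearMap
  { toFun := divJet
    map_add' := by intro p q; simp [divJet, Finset.sum_add_distrib]
    map_smul' := by intro c p; simp [divJet, Finset.mul_sum] }

/-- The cross product as a continuous bilinear map. -/
noncomputable def crossL : Vec3 →L[ℝ] Vec3 →L[ℝ] Vec3 :=
  LinearMap.toContinuousBilinearMap crossProduct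

theorem curlL_apply (p : Grad3) : curlL p = curlJet p := rfl

theorem curlL_eq (p : Grad3) : curlL p =
    ![p 2 1 - p 1 2, p 0 2 - p 2 0, p 1 0 - p 0 1] := rfl

theorem divL_apply (p : Grad3) : divL p = divJet p := rfl

theorem divL_eq (p : Grad3) : divL p = p 0 0 + p 1 1 + p 2 2 := by
  simp [divL_apply, divJet, Fin.sum_univ_three]

theorem crossL_apply (a b : Vec3) : crossL a b = crossProduct a b := rfl

theorem crossL_eq (a b : Vec3) : crossL a b =
    ![a 1 * b 2 - a 2 * b 1, a 2 * b 0 - a 0 * b 2, a 0 * b 1 - a 1 * b 0] := by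
  rw [crossL_apply, cross_apply]

/-- The direction of complete differentiation at a second-order jet. -/
def jetDir (J : Jet2) (i : Fin 3) : Jet1 :=
  (Pi.single i 1, fun k => J.base.2.2 k i, fun k l => J.h k l i)

theorem totalDeriv_eq {W : Type*} [NormedAddCommGroup W] [NormedSpace ℝ W] (i : Fin 3)
    (f : Jet1 → W) (J : Jet2) : totalDeriv i f J = fderiv ℝ f J.base (jetDir J i) := rfl

/-- The characteristic `η - u₁ ξ` of an infinitesimal operator. -/
noncomputable def InfOp.charac (X : InfOp) (j : Jet1) : Vec3 := X.η j - mv j.2.2 (X.ξ j)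

/-- The complete derivatives of the characteristic. -/
noncomputable def InfOp.characGrad (X : InfOp) (J : Jet2) : Grad3 := fun k i =>
  fderiv ℝ X.charac J.base (jetDir J i) k

theorem InfOp.SmoothOn.contDiffAt_charac {X : InfOp} {U : Set Jet1} (hU : IsOpen U)
    (hX : X.SmoothOn U) {j : Jet1} (hj : j ∈ U) : ContDiffAt ℝ ∞ X.charac j := by
  have h1 := hX.1.contDiffAt (hU.mem_nhds hj)
  have h2 := hX.2.contDiffAt (hU.mem_nhds hj)
  have h3 : ContDiffAt ℝ ∞ (fun j : Jet1 => mv j.2.2) j :=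
    mv.contDiff.contDiffAt.comp j (contDiff_snd.snd).contDiffAt
  exact h2.sub (h3.clm_apply h1)

/-- By the product rule D_i(u₁ξ) contains both u_m D_i ξ^m, which cancels against the prolongation
formula, and the contraction of the second derivatives with ξ, which remains. -/
theorem InfOp.SmoothOn.prolongCoeff_eq {X : InfOp} {U : Set Jet1} (hU : IsOpen U)
    (hX : X.SmoothOn U) {J : Jet2} (hJ : J.base ∈ U) :
    X.prolongCoeff J = X.characGrad J + fun k i => ∑ m, J.h k m i * X.ξ J.base m := by
  have h1 : DifferentiableAt ℝ X.ξ J.base :=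
    (hX.1.contDiffAt (hU.mem_nhds hJ)).differentiableAt (by simp)
  have h2 : DifferentiableAt ℝ X.η J.base :=
    (hX.2.contDiffAt (hU.mem_nhds hJ)).differentiableAt (by simp)
  have h3 : HasFDerivAt (fun j : Jet1 => j.2.2)
      ((ContinuousLinearMap.snd ℝ Vec3 Grad3).comp (ContinuousLinearMap.snd ℝ Vec3 _)) J.base :=
    ((ContinuousLinearMap.snd ℝ Vec3 Grad3).comp
      (ContinuousLinearMap.snd ℝ Vec3 (Vec3 × Grad3))).hasFDerivAt
  have h4 := h2.hasFDerivAt.sub ((mv.hasFDerivAt.comp J.base h3).clm_apply h1.hasFDerivAt)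
  have h5 : fderiv ℝ X.charac J.base = _ := h4.fderiv
  have c1 : ∀ m, fderiv ℝ (fun j => X.ξ j m) J.base =
      (ContinuousLinearMap.proj m).comp (fderiv ℝ X.ξ J.base) := fun m =>
    (hasFDerivAt_pi'.1 h1.hasFDerivAt m).fderiv
  have c2 : ∀ m, fderiv ℝ (fun j => X.η j m) J.base =
      (ContinuousLinearMap.proj m).comp (fderiv ℝ X.η J.base) := fun m =>
    (hasFDerivAt_pi'.1 h2.hasFDerivAt m).fderiv
  ext k i
  simp [InfOp.prolongCoeff, InfOp.characGrad, totalDeriv_eq, h5, c1, c2, mv_apply,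
    Fin.sum_univ_three, jetDir]
  ring

theorem fderiv_vacuumSys (j d : Jet1) :
    fderiv ℝ vacuumSys j d = (curlL d.2.2, divL d.2.2) := by
  have h : vacuumSys = ((curlL.prod divL).comp ((ContinuousLinearMap.snd ℝ Vec3 Grad3).comp
      (ContinuousLinearMap.snd ℝ Vec3 (Vec3 × Grad3))) : Jet1 →L[ℝ] Vec3 × ℝ) := rfl
  rw [h, ContinuousLinearMap.fderiv]; rfl

theorem fderiv_forceFreeSys (j d : Jet1) : fderiv ℝ forceFreeSys j d =
    (crossL (curlL d.2.2) j.2.1 + crossL (curlL j.2.2) d.2.1, divL d.2.2) := by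
  have h3 : HasFDerivAt (fun j : Jet1 => j.2.2)
      ((ContinuousLinearMap.snd ℝ Vec3 Grad3).comp (ContinuousLinearMap.snd ℝ Vec3 _)) j :=
    ((ContinuousLinearMap.snd ℝ Vec3 Grad3).comp
      (ContinuousLinearMap.snd ℝ Vec3 (Vec3 × Grad3))).hasFDerivAt
  have h2 : HasFDerivAt (fun j : Jet1 => j.2.1)
      ((ContinuousLinearMap.fst ℝ Vec3 Grad3).comp (ContinuousLinearMap.snd ℝ Vec3 _)) j :=
    ((ContinuousLinearMap.fst ℝ Vec3 Grad3).comp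
      (ContinuousLinearMap.snd ℝ Vec3 (Vec3 × Grad3))).hasFDerivAt
  have h4 := (((crossL.comp curlL).hasFDerivAt.comp j h3).clm_apply h2).prodMk
    (divL.hasFDerivAt.comp j h3)
  have h5 : fderiv ℝ forceFreeSys j = _ := h4.fderiv
  rw [h5]
  simp [add_comm]

theorem curlL_contract (J : Jet2) (v : Vec3) :
    curlL (fun k i => ∑ m, J.h k m i * v m) =
      ∑ m, v m • curlL (fun k l => J.h k l m) := by
  ext s
  fin_cases s <;> simp [curlL_eq, Fin.sum_univ_three, J.symm _ 1 0, J.symm _ 2 0, J.symm _ 2 1] <;>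
    ring

theorem divL_contract (J : Jet2) (v : Vec3) :
    divL (fun k i => ∑ m, J.h k m i * v m) = ∑ m, v m • divL (fun k l => J.h k l m) := by
  simp [divL_eq, Fin.sum_univ_three, J.symm _ 1 0, J.symm _ 2 0, J.symm _ 2 1]
  ring

theorem onSystem_vacuumSys_iff {J : Jet2} : OnSystem vacuumSys J ↔
    curlL J.base.2.2 = 0 ∧ divL J.base.2.2 = 0 ∧
      ∀ i, curlL (fun k l => J.h k l i) = 0 ∧ divL (fun k l => J.h k l i) = 0 := by
  simp [OnSystem, totalDeriv_eq, fderiv_vacuumSys, jetDir, vacuumSys, curlL_apply, divL_apply,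
    and_assoc]

theorem onSystem_forceFreeSys_iff {J : Jet2} : OnSystem forceFreeSys J ↔
    crossL (curlL J.base.2.2) J.base.2.1 = 0 ∧ divL J.base.2.2 = 0 ∧
      ∀ i, crossL (curlL fun k l => J.h k l i) J.base.2.1 +
        crossL (curlL J.base.2.2) (fun k => J.base.2.2 k i) = 0 ∧
        divL (fun k l => J.h k l i) = 0 := by
  simp [OnSystem, totalDeriv_eq, fderiv_forceFreeSys, jetDir, forceFreeSys, curlL_apply,
    divL_apply, crossL_apply, and_assoc]

/-- The term with ξ contracts the second derivatives with ξ; its curl and divergence are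
combinations of D_m E and vanish on the system. -/
theorem ModifiedDetermining.vacuum {U : Set Jet1} (hU : IsOpen U) {α : Vec3 → Grad3 → ℝ}
    {X : InfOp} (hX : X.SmoothOn U) (h : ModifiedDetermining U vacuumSys (forceFreeRhs α) X)
    {J : Jet2} (hJ : J.base ∈ U) (hs : OnSystem vacuumSys J) :
    curlL (X.characGrad J) = α J.base.2.1 J.base.2.2 • J.base.2.1 ∧
      divL (X.characGrad J) = 0 := by
  have h1 := h J hJ hs
  have h2 := onSystem_vacuumSys_iff.1 hs
  rw [InfOp.prolong, fderiv_vacuumSys, hX.prolongCoeff_eq hU hJ, forceFreeRhs, Prod.mk.injEq] at h1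
  simpa [curlL_contract, divL_contract, h2.2.2] using h1

/-- Here the system also contains u itself, so η is split as Q + u₁ξ; the part u₁ξ combines with the
second-derivative term into ∑ ξ^m D_m E = 0. -/
theorem ModifiedDetermining.forceFree {U : Set Jet1} (hU : IsOpen U) {P : Jet1 → ℝ}
    {X : InfOp} (hX : X.SmoothOn U) (h : ModifiedDetermining U forceFreeSys (plasmaRhs P) X)
    {J : Jet2} (hJ : J.base ∈ U) (hs : OnSystem forceFreeSys J) :
    crossL (curlL (X.characGrad J)) J.base.2.1 + crossL (curlL J.base.2.2) (X.charac J.base) =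
      (fun i => fderiv ℝ P J.base (jetDir J i)) ∧
      divL (X.characGrad J) = 0 := by
  have h1 := h J hJ hs
  have h2 := onSystem_forceFreeSys_iff.1 hs
  rw [InfOp.prolong, fderiv_forceFreeSys, hX.prolongCoeff_eq hU hJ, plasmaRhs,
    Prod.mk.injEq] at h1
  refine ⟨?_, by simpa [divL_contract, h2.2.2] using h1.2⟩
  have h3 : ∀ i, crossL (curlL fun k l => J.h k l i) J.base.2.1 =
      -crossL (curlL J.base.2.2) (fun k => J.base.2.2 k i) := fun i =>
    eq_neg_of_add_eq_zero_left (h2.2.2 i).1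
  have h4 : mv J.base.2.2 (X.ξ J.base) =
      ∑ i, X.ξ J.base i • (fun k => J.base.2.2 k i : Vec3) := by
    ext k; simp [mv_apply, Fin.sum_univ_three]; ring
  have h5 : X.η J.base = X.charac J.base +
      ∑ i, X.ξ J.base i • (fun k => J.base.2.2 k i : Vec3) := by
    rw [← h4, InfOp.charac]; abel
  have h6 : (fun i => totalDeriv i P J) = fun i => fderiv ℝ P J.base (jetDir J i) := rfl
  rw [← h6, ← h1.1]
  simp [curlL_contract, h3, h5]
  abel

/-! ### Coefficients of the quadratic gradient -/

/-- The matrix product as a continuous bilinear map. -/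
noncomputable def mm : Grad3 →L[ℝ] Grad3 →L[ℝ] Grad3 :=
  LinearMap.toContinuousBilinearMap
    (LinearMap.mk₂ ℝ (fun (p q : Grad3) => fun k i => ∑ l, p k l * q l i)
      (fun p q v => by ext; simp [add_mul, Finset.sum_add_distrib])
      (fun c p v => by ext; simp [Finset.mul_sum, mul_assoc])
      (fun p v w => by ext; simp [mul_add, Finset.sum_add_distrib])
      (fun c p v => by ext; simp [Finset.mul_sum, mul_left_comm]))

theorem mm_apply (p q : Grad3) (k i : Fin 3) :
    mm p q k i = p k 0 * q 0 i + p k 1 * q 1 i + p k 2 * q 2 i := by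
  have : mm p q k i = ∑ l, p k l * q l i := rfl
  rw [this, Fin.sum_univ_three]

/-- The quadratic expression of the gradient of a characteristic `p v + w` in terms of `p` and of
the partial derivatives of `v` and `w`. -/
noncomputable def quadGrad (X V Z W p : Grad3) : Grad3 :=
  mm p X + mm p (mm V p) + Z + mm W p

/-- A quadratic polynomial vanishing on the line s₀ + tc for small t has zero coefficients. The
fixed summand p will be 0 for vacuum fields and (λ/2) `rot u` for force-free ones. -/
theorem quadGrad_coeff (l : Grad3 →L[ℝ] ℝ) {X V Z W p : Grad3} {s₀ : Fin 5 → ℝ} {r : ℝ}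
    (hr : 0 < r)
    (h : ∀ s ∈ Metric.ball s₀ r, l (quadGrad X V Z W (stf s + p)) = 0) (c : Fin 5 → ℝ) :
    l (mm (stf c) X + mm (stf s₀ + p) (mm V (stf c)) + mm (stf c) (mm V (stf s₀ + p)) +
      mm W (stf c)) = 0 ∧ l (mm (stf c) (mm V (stf c))) = 0 := by
  have hc : 0 < ‖c‖ + 1 := by positivity
  have := quadratic_coeff_eq_zero (a := l (quadGrad X V Z W (stf s₀ + p)))
    (b := l (mm (stf c) X + mm (stf s₀ + p) (mm V (stf c)) + mm (stf c) (mm V (stf s₀ + p)) +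
      mm W (stf c))) (c := l (mm (stf c) (mm V (stf c)))) (ε := r / (‖c‖ + 1)) (by positivity) (by
      intro t ht
      have hm : s₀ + t • c ∈ Metric.ball s₀ r := by
        rw [mem_ball_iff_norm, add_sub_cancel_left, norm_smul, Real.norm_eq_abs]
        rw [lt_div_iff₀ hc] at ht
        nlinarith [abs_nonneg t]
      rw [← h _ hm, quadGrad, quadGrad]
      simp
      ring)
  exact this.2

/-- tr(cVc) = tr(Vc²), and the squares of symmetric traceless matrices span all symmetric matrices.
-/
theorem antisymm_of_divL_eq_zero {V : Grad3}
    (h : ∀ c, divL (mm (stf c) (mm V (stf c))) = 0) :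
    V 0 0 = 0 ∧ V 1 1 = 0 ∧ V 2 2 = 0 ∧ V 1 0 = -V 0 1 ∧ V 2 0 = -V 0 2 ∧ V 2 1 = -V 1 2 := by
  have h1 := h ![0, 0, 1, 0, 0]
  have h2 := h ![0, 0, 0, 1, 0]
  have h3 := h ![0, 0, 0, 0, 1]
  have h4 := h ![0, 0, 1, 1, 0]
  have h5 := h ![0, 0, 1, 0, 1]
  have h6 := h ![0, 0, 0, 1, 1]
  simp [divL_eq, mm_apply, stf_eq] at h1 h2 h3 h4 h5 h6
  refine ⟨?_, ?_, ?_, ?_, ?_, ?_⟩ <;> linarith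

/-- For antisymmetric V with axial vector b the matrix cVc is antisymmetric with axial vector cof(c)
b. These vectors cannot all be parallel to one u unless b = 0. -/
theorem eq_zero_of_cross_curlL_eq_zero {V : Grad3} {u : Vec3} (hu : u ≠ 0)
    (h : ∀ c, divL (mm (stf c) (mm V (stf c))) = 0)
    (h' : ∀ c, crossL (curlL (mm (stf c) (mm V (stf c)))) u = 0) : V = 0 := by
  obtain ⟨v00, v11, v22, v10, v20, v21⟩ := antisymm_of_divL_eq_zero h
  have e (c : Fin 5 → ℝ) (k : Fin 3) := congrFun (h' c) k
  have h1 := e ![0, 0, 1, 0, 0]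
  have h2 := e ![0, 0, 0, 1, 0]
  have h3 := e ![0, 0, 0, 0, 1]
  have h4 := e ![0, 0, 1, 1, 0]
  have h5 := e ![0, 0, 1, 0, 1]
  have h6 := e ![0, 0, 0, 1, 1]
  simp only [Fin.forall_fin_succ, crossL_eq, curlL_eq, mm_apply, stf_eq] at h1 h2 h3 h4 h5 h6
  simp [v00, v11, v22, v10, v20, v21] at h1 h2 h3 h4 h5 h6
  have h0 : V 0 1 = 0 ∧ V 0 2 = 0 ∧ V 1 2 = 0 := by
    by_contra hne
    apply hu
    ext k
    fin_cases k <;> simp <;> grind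
  obtain ⟨v01, v02, v12⟩ := h0
  ext i j
  fin_cases i <;> fin_cases j <;> simp [v00, v11, v22, v10, v20, v21, v01, v02, v12]

theorem eq_smul_of_cross_eq_zero {a u : Vec3} (hu : u ≠ 0) (h : crossL a u = 0) :
    a = ((u 0 * a 0 + u 1 * a 1 + u 2 * a 2) / (u 0 ^ 2 + u 1 ^ 2 + u 2 ^ 2)) • u := by
  have hu' := (sq_pos_of_ne_zero hu).ne'
  have h0 := congrFun h 0
  have h1 := congrFun h 1
  have h2 := congrFun h 2
  simp [crossL_eq] at h0 h1 h2
  ext k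
  fin_cases k <;> simp <;> field_simp
  · linear_combination u 1 * h2 - u 2 * h1
  · linear_combination u 2 * h0 - u 0 * h2
  · linear_combination u 0 * h1 - u 1 * h0

/-- The curl of cX + Wc has the form τ(c)u. Contracting it with a harmonic tensor gives zero
identically, because an antisymmetric symbol meets a symmetric one; so τ = 0 by
`eq_zero_of_harm_contract`. What remains says that cX + Wc is symmetric and traceless for all c,
which forces W and X to be conformal with opposite off-diagonal entries. -/
theorem conformal_of_linear_part {X W : Grad3} {u : Vec3} (hu : u ≠ 0)
    (h : ∀ c, divL (mm (stf c) X + mm W (stf c)) = 0)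
    (h' : ∀ c, crossL (curlL (mm (stf c) X + mm W (stf c))) u = 0) :
    (∀ c, curlL (mm (stf c) X + mm W (stf c)) = 0) ∧
    (∀ k l, k ≠ l → W k l = -X k l) ∧ ∀ k l, W k k = W l l := by
  have hF : ∀ c, curlL (mm (stf c) X + mm W (stf c)) = 0 := by
    obtain ⟨F, hF⟩ : ∃ F : (Fin 5 → ℝ) →ₗ[ℝ] Vec3,
        ∀ c, F c = curlL (mm (stf c) X + mm W (stf c)) :=
      ⟨(curlL.comp ((mm.flip X).comp stf + (mm W).comp stf)).toLinearMap, fun c => rfl⟩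
    obtain ⟨τ, hτ⟩ : ∃ τ : Fin 5 → ℝ, ∀ c, F c = (∑ a, τ a * c a) • u := by
      refine ⟨fun a => (u 0 * F (Pi.single a 1) 0 + u 1 * F (Pi.single a 1) 1 +
        u 2 * F (Pi.single a 1) 2) / (u 0 ^ 2 + u 1 ^ 2 + u 2 ^ 2), fun c => ?_⟩
      have h1 : ∀ c, crossL (F c) u = 0 := fun c => by rw [hF]; exact h' c
      have hc : F c = ∑ a, c a • F (Pi.single a 1) := by
        conv_lhs => rw [pi_eq_sum_univ' c]
        simp
      rw [hc, Finset.sum_smul]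
      refine Finset.sum_congr rfl fun a _ => ?_
      conv_lhs => rw [eq_smul_of_cross_eq_zero hu (h1 (Pi.single a 1)), smul_smul, mul_comm]
    have hz : τ = 0 := by
      refine eq_zero_of_harm_contract hu fun t => ?_
      have h1 : ∀ i, u i * ∑ a, τ a * stfCoord (fun k l => harm t k l i) a =
          F (stfCoord fun k l => harm t k l i) i := fun i => by
        rw [hτ]; simp [mul_comm]
      simp only [h1, hF]
      simp [Fin.sum_univ_three, curlL_eq, mm_apply, stf_eq, stfCoord, harm]
      ring
    intro c
    rw [← hF, hτ, hz]; simp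
  have e (c : Fin 5 → ℝ) (k : Fin 3) := congrFun (hF c) k
  have h1 := e ![1, 0, 0, 0, 0]
  have h2 := e ![0, 1, 0, 0, 0]
  have h3 := e ![0, 0, 1, 0, 0]
  have h4 := e ![0, 0, 0, 1, 0]
  have h5 := e ![0, 0, 0, 0, 1]
  have g1 := h ![1, 0, 0, 0, 0]
  have g2 := h ![0, 1, 0, 0, 0]
  have g3 := h ![0, 0, 1, 0, 0]
  have g4 := h ![0, 0, 0, 1, 0]
  have g5 := h ![0, 0, 0, 0, 1]
  simp only [Fin.forall_fin_succ, curlL_eq, Pi.add_apply, mm_apply, stf_eq] at h1 h2 h3 h4 h5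
  simp only [divL_eq, Pi.add_apply, mm_apply, stf_eq] at g1 g2 g3 g4 g5
  simp at h1 h2 h3 h4 h5 g1 g2 g3 g4 g5
  refine ⟨hF, ?_, ?_⟩
  · intro k l hkl
    fin_cases k <;> fin_cases l <;> simp at hkl ⊢ <;> linarith
  · intro k l
    fin_cases k <;> fin_cases l <;> simp <;> linarith

/-- M d parallel to d for every d makes M scalar, and trace zero makes it 0; then d × F₀ = 0 for all
d. -/
theorem eq_zero_of_cross_affine {F₀ u₀ : Vec3} (M : Vec3 →ₗ[ℝ] Vec3)
    (h1 : ∀ d, crossL d (M d) = 0) (h2 : ∀ d, crossL u₀ (M d) + crossL d F₀ = 0)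
    (h3 : ∑ s, M (Pi.single s 1) s = 0) : F₀ = 0 := by
  have e (k : Fin 3) := h1 (Pi.single k 1)
  have e' (k l : Fin 3) : crossL (Pi.single k 1 + Pi.single l 1)
      (M (Pi.single k 1) + M (Pi.single l 1)) = 0 := by
    rw [← M.map_add]; exact h1 _
  have m0 := e 0
  have m1 := e 1
  have m2 := e 2
  have m3 := e' 0 1
  have m4 := e' 0 2
  have m5 := e' 1 2
  rw [Fin.sum_univ_three] at h3
  simp only [funext_iff, Fin.forall_fin_succ, crossL_eq, Pi.single_apply] at m0 m1 m2 m3 m4 m5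
  simp at m0 m1 m2 m3 m4 m5
  have z : ∀ k, M (Pi.single k 1) = 0 := by
    intro k
    ext l
    fin_cases k <;> fin_cases l <;> simp <;> linarith
  have f0 := h2 (Pi.single 0 1)
  have f1 := h2 (Pi.single 1 1)
  simp only [z, map_zero, zero_add, funext_iff, Fin.forall_fin_succ, crossL_eq, Pi.single_apply] at f0 f1
  simp at f0 f1
  ext k
  fin_cases k <;> simp <;> grind

/-! ### Jets of vacuum fields -/

theorem harm_symm (t : Fin 7 → ℝ) (k i l : Fin 3) : harm t k i l = harm t k l i := by
  fin_cases k <;> fin_cases i <;> fin_cases l <;> rfl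

theorem curlL_harm (t : Fin 7 → ℝ) (i : Fin 3) : curlL (fun a b => harm t a b i) = 0 := by
  ext k
  fin_cases i <;> fin_cases k <;> simp [curlL_eq, harm]

theorem divL_harm (t : Fin 7 → ℝ) (i : Fin 3) : divL (fun a b => harm t a b i) = 0 := by
  fin_cases i <;> simp [divL_eq, harm] <;> ring

theorem stf_stfCoord_harm (t : Fin 7 → ℝ) (i : Fin 3) :
    stf (stfCoord fun a b => harm t a b i) = fun a b => harm t a b i := by
  have h := eq_stf_add_rot (p := fun a b => harm t a b i) (divL_harm t i)
  rw [← curlL_apply, curlL_harm] at h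
  simpa using h.symm

theorem stfCoord_harm_zero (i : Fin 3) : stfCoord (fun a b => harm 0 a b i) = 0 := by
  ext a
  fin_cases a <;> fin_cases i <;> simp [stfCoord, harm]

/-- The jets of vacuum fields. -/
noncomputable def vacChart : (Vec3 × Vec3) × (Fin 5 → ℝ) →L[ℝ] Jet1 :=
  ((ContinuousLinearMap.fst ℝ Vec3 Vec3).comp (ContinuousLinearMap.fst ℝ _ _)).prod
    (((ContinuousLinearMap.snd ℝ Vec3 Vec3).comp (ContinuousLinearMap.fst ℝ _ _)).prod
      (stf.comp (ContinuousLinearMap.snd ℝ _ _)))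

theorem vacChart_apply (x u : Vec3) (s : Fin 5 → ℝ) : vacChart ((x, u), s) = (x, u, stf s) := rfl

/-- The second-order jets of vacuum fields. -/
noncomputable def vacJet (z : (Vec3 × Vec3) × (Fin 5 → ℝ)) (t : Fin 7 → ℝ) : Jet2 where
  base := vacChart z
  h := harm t
  symm := harm_symm t

theorem curlL_stf (s : Fin 5 → ℝ) : curlL (stf s) = 0 := by
  ext k
  fin_cases k <;> simp [curlL_eq, stf_eq]

theorem divL_stf (s : Fin 5 → ℝ) : divL (stf s) = 0 := by
  simp [divL_eq, stf_eq]

theorem onSystem_vacJet (z : (Vec3 × Vec3) × (Fin 5 → ℝ)) (t : Fin 7 → ℝ) :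
    OnSystem vacuumSys (vacJet z t) :=
  onSystem_vacuumSys_iff.2 ⟨curlL_stf _, divL_stf _, fun i => ⟨curlL_harm t i, divL_harm t i⟩⟩

theorem characGrad_vacJet {X : InfOp} {z : (Vec3 × Vec3) × (Fin 5 → ℝ)} (t : Fin 7 → ℝ)
    (hX : ContDiffAt ℝ ∞ X.charac (vacChart z)) :
    X.characGrad (vacJet z t) = fun k i => fderiv ℝ (fun z => X.charac (vacChart z)) z
      ((Pi.single i 1, fun k => stf z.2 k i), stfCoord fun a b => harm t a b i) k := by
  have h := ((hX.differentiableAt (by simp)).hasFDerivAt.comp z vacChart.hasFDerivAt).fderiv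
  rw [Function.comp_def] at h
  rw [h]
  ext k i
  rw [ContinuousLinearMap.comp_apply, vacChart_apply (Pi.single i 1), stf_stfCoord_harm]
  rfl

theorem fderiv_mv_stf_add {Y : Type*} [NormedAddCommGroup Y] [NormedSpace ℝ Y]
    {Q : Y × (Fin 5 → ℝ) → Vec3} {v w : Y → Vec3} {z : Y × (Fin 5 → ℝ)}
    (hQ : Q =ᶠ[nhds z] fun z => mv (stf z.2) (v z.1) + w z.1)
    (hv : DifferentiableAt ℝ v z.1) (hw : DifferentiableAt ℝ w z.1) (d : Y × (Fin 5 → ℝ)) :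
    fderiv ℝ Q z d = mv (stf d.2) (v z.1) + mv (stf z.2) (fderiv ℝ v z.1 d.1) +
      fderiv ℝ w z.1 d.1 := by
  have h1 : HasFDerivAt (fun z : Y × (Fin 5 → ℝ) => z.1) (ContinuousLinearMap.fst ℝ Y _) z :=
    hasFDerivAt_fst
  have h2 := ((mv.comp stf).hasFDerivAt.comp z hasFDerivAt_snd).clm_apply
    (hv.hasFDerivAt.comp z h1)
  have h3 := (h2.add (hw.hasFDerivAt.comp z h1)).fderiv
  rw [hQ.fderiv_eq]
  refine (congrArg (fun L => L d) h3).trans ?_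
  simp [add_comm]

theorem sum_smul_single (a : Vec3) : a = ∑ m, a m • (Pi.single m 1 : Vec3) := by
  conv_lhs => rw [pi_eq_sum_univ' a]

/-! ### The part of the characteristic free of first derivatives -/

/-- Derivative along the position, then the curl. -/
noncomputable def curlX (f : Vec3 × Vec3 → Vec3) (y : Vec3 × Vec3) : Vec3 :=
  curlL fun k i => fderiv ℝ f y (Pi.single i 1, 0) k

theorem contDiffAt_gradX {f : Vec3 × Vec3 → Vec3} {y : Vec3 × Vec3} (hf : ContDiffAt ℝ ∞ f y) :
    ContDiffAt ℝ ∞ (fun y => (fun k i => fderiv ℝ f y (Pi.single i 1, 0) k : Grad3)) y :=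
  contDiffAt_pi.2 fun k => contDiffAt_pi.2 fun i =>
    contDiffAt_pi.1 (contDiffAt_fderiv_apply hf (Pi.single i 1, 0)) k

theorem contDiffAt_curlX {f : Vec3 × Vec3 → Vec3} {y : Vec3 × Vec3} (hf : ContDiffAt ℝ ∞ f y) :
    ContDiffAt ℝ ∞ (curlX f) y :=
  curlL.contDiff.contDiffAt.comp y (contDiffAt_gradX hf)

theorem fderiv_curlX {f : Vec3 × Vec3 → Vec3} {y : Vec3 × Vec3} (hf : ContDiffAt ℝ ∞ f y)
    (d : Vec3 × Vec3) :
    fderiv ℝ (curlX f) y d = curlX (fun y => fderiv ℝ f y d) y := by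
  have hg := (contDiffAt_gradX hf).differentiableAt (by simp)
  have h1 := (curlL.hasFDerivAt.comp y hg.hasFDerivAt).fderiv
  refine (congrArg (fun L => L d) h1).trans ?_
  rw [ContinuousLinearMap.comp_apply, curlX]
  congr 1
  ext k i
  rw [← fderiv_fderiv_apply_comm hf]
  have h2 := (hasFDerivAt_pi'.1 (hasFDerivAt_pi'.1 hg.hasFDerivAt k) i).fderiv
  have h3 := (hasFDerivAt_pi'.1 ((contDiffAt_fderiv_apply hf
    (Pi.single i 1, (0 : Vec3))).differentiableAt (by simp)).hasFDerivAt k).fderiv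
  have h4 := h2.symm.trans h3
  exact congrArg (fun L => L d) h4

theorem curlX_congr {f g : Vec3 × Vec3 → Vec3} {y : Vec3 × Vec3} (h : f =ᶠ[nhds y] g) :
    curlX f y = curlX g y := by
  rw [curlX, curlX, h.fderiv_eq]

/-- If `v` depends on the position only and the derivative of `w` along the field is conformal with
antisymmetric part opposite to that of `v`, then `w` is affine in the field. -/
theorem fderiv_fderiv_field_eq_zero {v w : Vec3 × Vec3 → Vec3} {B : Set (Vec3 × Vec3)}
    (hB : IsOpen B) (hv : ∀ y ∈ B, ContDiffAt ℝ ∞ v y) (hw : ∀ y ∈ B, ContDiffAt ℝ ∞ w y)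
    (hv0 : ∀ y ∈ B, ∀ d, fderiv ℝ v y (0, d) = 0)
    (hvw : ∀ y ∈ B, ∀ k l, k ≠ l →
      fderiv ℝ w y (0, Pi.single l 1) k = -fderiv ℝ v y (Pi.single l 1, 0) k)
    (hww : ∀ y ∈ B, ∀ k l,
      fderiv ℝ w y (0, Pi.single k 1) k = fderiv ℝ w y (0, Pi.single l 1) l)
    {y : Vec3 × Vec3} (hy : y ∈ B) (d e : Vec3) :
    fderiv ℝ (fun y => fderiv ℝ w y (0, d)) y (0, e) = 0 := by
  have comp : ∀ {f : Vec3 × Vec3 → Vec3}, ContDiffAt ℝ ∞ f y → ∀ k a,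
      fderiv ℝ (fun y => f y k) y a = fderiv ℝ f y a k := fun hf k a =>
    congrArg (fun L => L a) (hasFDerivAt_pi'.1 (hf.differentiableAt (by simp)).hasFDerivAt k).fderiv
  have hws : ∀ a, ContDiffAt ℝ ∞ (fun y => fderiv ℝ w y a) y := contDiffAt_fderiv_apply (hw y hy)
  have hvs : ∀ a, ContDiffAt ℝ ∞ (fun y => fderiv ℝ v y a) y := contDiffAt_fderiv_apply (hv y hy)
  have off : ∀ k l m, k ≠ l →
      fderiv ℝ (fun y => fderiv ℝ w y (0, Pi.single l 1)) y (0, Pi.single m 1) k = 0 := by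
    intro k l m hkl
    have h1 : (fun y => fderiv ℝ w y (0, Pi.single l 1) k) =ᶠ[nhds y]
        fun y => -fderiv ℝ v y (Pi.single l 1, 0) k := by
      filter_upwards [hB.mem_nhds hy] with y' hy'
      exact hvw y' hy' k l hkl
    have h2 : (fun y => fderiv ℝ v y (0, Pi.single m 1)) =ᶠ[nhds y] fun _ => 0 := by
      filter_upwards [hB.mem_nhds hy] with y' hy'
      exact hv0 y' hy' _
    rw [← comp (hws _), h1.fderiv_eq, fderiv_fun_neg, neg_apply,
      comp (hvs _), fderiv_fderiv_apply_comm (hv y hy), h2.fderiv_eq]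
    simp
  have all : ∀ k l m,
      fderiv ℝ (fun y => fderiv ℝ w y (0, Pi.single l 1)) y (0, Pi.single m 1) k = 0 := by
    intro k l m
    by_cases hkl : k = l
    -- An off-diagonal second derivative vanishes because there ∂w/∂u = -∂v/∂x does not depend on u.
    -- A diagonal entry is reduced to this case by exchanging the order of differentiation, after
    -- passing to another diagonal entry if all three indices agree.
    · subst hkl
      by_cases hkm : k = m
      · subst hkm
        obtain ⟨n, hn⟩ : ∃ n : Fin 3, n ≠ k := exists_ne k
        have h1 : (fun y => fderiv ℝ w y (0, Pi.single k 1) k) =ᶠ[nhds y]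
            fun y => fderiv ℝ w y (0, Pi.single n 1) n := by
          filter_upwards [hB.mem_nhds hy] with y' hy'
          exact hww y' hy' k n
        rw [← comp (hws _), h1.fderiv_eq, comp (hws _), fderiv_fderiv_apply_comm (hw y hy)]
        exact off n k n hn
      · rw [fderiv_fderiv_apply_comm (hw y hy)]
        exact off k m k hkm
    · exact off k l m hkl
  have single : ∀ l m,
      fderiv ℝ (fun y => fderiv ℝ w y (0, Pi.single l 1)) y (0, Pi.single m 1) = 0 := fun l m =>
    funext fun k => all k l m
  have pair : ∀ a : Vec3, ((0, a) : Vec3 × Vec3) = ∑ m, a m • ((0, Pi.single m 1) : Vec3 × Vec3) := by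
    intro a
    conv_lhs => rw [sum_smul_single a]
    simp [Fin.sum_univ_three]
  have right : ∀ l, fderiv ℝ (fun y => fderiv ℝ w y (0, Pi.single l 1)) y (0, e) = 0 := by
    intro l
    rw [pair e, map_sum]
    refine Finset.sum_eq_zero fun m _ => ?_
    rw [map_smul, single, smul_zero]
  rw [fderiv_fderiv_apply_comm (hw y hy), pair d, map_sum]
  refine Finset.sum_eq_zero fun m _ => ?_
  rw [map_smul, fderiv_fderiv_apply_comm (hw y hy), right, smul_zero]

/-- Under the same hypotheses, if the curl of `w` is everywhere parallel to the field then it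
vanishes. -/
theorem curlX_eq_zero {v w : Vec3 × Vec3 → Vec3} {y₀ : Vec3 × Vec3} {r : ℝ} (hr : 0 < r)
    (hv : ∀ y ∈ Metric.ball y₀ r, ContDiffAt ℝ ∞ v y)
    (hw : ∀ y ∈ Metric.ball y₀ r, ContDiffAt ℝ ∞ w y)
    (hv0 : ∀ y ∈ Metric.ball y₀ r, ∀ d, fderiv ℝ v y (0, d) = 0)
    (hvw : ∀ y ∈ Metric.ball y₀ r, ∀ k l, k ≠ l →
      fderiv ℝ w y (0, Pi.single l 1) k = -fderiv ℝ v y (Pi.single l 1, 0) k)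
    (hww : ∀ y ∈ Metric.ball y₀ r, ∀ k l,
      fderiv ℝ w y (0, Pi.single k 1) k = fderiv ℝ w y (0, Pi.single l 1) l)
    (hpar : ∀ y ∈ Metric.ball y₀ r, crossL y.2 (curlX w y) = 0) : curlX w y₀ = 0 := by
  have h0 : y₀ ∈ Metric.ball y₀ r := Metric.mem_ball_self hr
  have hopen : IsOpen (Metric.ball y₀ r) := Metric.isOpen_ball
  have hF : ∀ y ∈ Metric.ball y₀ r, ContDiffAt ℝ ∞ (curlX w) y := fun y hy =>
    contDiffAt_curlX (hw y hy)
  have hF2 : ∀ y ∈ Metric.ball y₀ r, ∀ d e,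
      fderiv ℝ (fun y => fderiv ℝ (curlX w) y (0, d)) y (0, e) = 0 := by
    intro y hy d e
    have h1 : (fun y => fderiv ℝ (curlX w) y (0, d)) =ᶠ[nhds y]
        curlX (fun y => fderiv ℝ w y (0, d)) := by
      filter_upwards [hopen.mem_nhds hy] with y' hy'
      exact fderiv_curlX (hw y' hy') _
    have h2 : (fun y => fderiv ℝ (fun y => fderiv ℝ w y (0, d)) y (0, e)) =ᶠ[nhds y]
        fun _ => 0 := by
      filter_upwards [hopen.mem_nhds hy] with y' hy'
      exact fderiv_fderiv_field_eq_zero hopen hv hw hv0 hvw hww hy' d e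
    rw [h1.fderiv_eq, fderiv_curlX (contDiffAt_fderiv_apply (hw y hy) _), curlX_congr h2]
    simp only [curlX, fderiv_const_apply, zero_apply]
    exact map_zero curlL
  obtain ⟨M, hM⟩ : ∃ M : Vec3 →ₗ[ℝ] Vec3, ∀ d, M d = fderiv ℝ (curlX w) y₀ (0, d) :=
    ⟨(fderiv ℝ (curlX w) y₀).toLinearMap ∘ₗ LinearMap.inr ℝ Vec3 Vec3, fun d => rfl⟩
  have hM1 : ∀ d, (y₀.1, y₀.2 + d) ∈ Metric.ball y₀ r →
      ∀ e, fderiv ℝ (curlX w) (y₀.1, y₀.2 + d) (0, e) = M e := by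
    intro d hd e
    rw [hM]
    refine (eq_of_fderiv_apply_sub_eq_zero (f := fun y => fderiv ℝ (curlX w) y (0, e))
      (convex_ball y₀ r) (fun z hz => (contDiffAt_fderiv_apply (hF z hz) _).differentiableAt
        (by simp)) h0 hd fun z hz => ?_).symm
    have : ((y₀.1, y₀.2 + d) : Vec3 × Vec3) - y₀ = (0, d) := by ext <;> simp
    rw [this]; exact hF2 z hz e d
  have haff : ∀ d, (y₀.1, y₀.2 + d) ∈ Metric.ball y₀ r →
      curlX w (y₀.1, y₀.2 + d) = curlX w y₀ + M d := by
    intro d hd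
    obtain ⟨L, hL⟩ : ∃ L : Vec3 × Vec3 →L[ℝ] Vec3, L = fderiv ℝ (curlX w) y₀ := ⟨_, rfl⟩
    have hsub : ((y₀.1, y₀.2 + d) : Vec3 × Vec3) - y₀ = (0, d) := by ext <;> simp
    -- Only derivatives along the field are controlled, so the comparison with the affine map takes
    -- place on the slice of fixed position.
    have hconv : Convex ℝ (Metric.ball y₀ r ∩ {y | y.1 = y₀.1}) :=
      (convex_ball y₀ r).inter
        ((convex_singleton y₀.1).linear_preimage (LinearMap.fst ℝ Vec3 Vec3))
    have h1 := eq_of_fderiv_apply_sub_eq_zero (f := fun y => curlX w y - L y) hconv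
      (fun z hz => ((hF z hz.1).differentiableAt (by simp)).sub L.differentiableAt)
      ⟨h0, rfl⟩ ⟨hd, rfl⟩ (fun z hz => by
        have hz' : (y₀.1, y₀.2 + (z.2 - y₀.2)) = z := by
          rw [add_sub_cancel]; exact Prod.ext hz.2.symm rfl
        rw [fderiv_fun_sub ((hF z hz.1).differentiableAt (by simp)) L.differentiableAt, hsub,
          ContinuousLinearMap.fderiv, sub_apply, ← hz', hM1 _ (by rw [hz']; exact hz.1), hM, hL,
          sub_self])
    have h2 : L (y₀.1, y₀.2 + d) = L y₀ + M d := by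
      rw [hM, ← hL, ← hsub, map_sub]; abel
    rw [h2] at h1
    linear_combination (exp := 1) -h1
  -- Parallelism on y₀ + t(0, d) is a quadratic polynomial identity in t; these are its t² and t
  -- coefficients.
  have hpoly : ∀ d, crossL d (M d) = 0 ∧
      crossL y₀.2 (M d) + crossL d (curlX w y₀) = 0 := by
    intro d
    have key : ∀ k, crossL d (M d) k = 0 ∧
        (crossL y₀.2 (M d) + crossL d (curlX w y₀)) k = 0 := by
      intro k
      have hd : 0 < ‖d‖ + 1 := by positivity
      have := quadratic_coeff_eq_zero (a := crossL y₀.2 (curlX w y₀) k)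
        (b := (crossL y₀.2 (M d) + crossL d (curlX w y₀)) k) (c := crossL d (M d) k)
        (ε := r / (‖d‖ + 1)) (by positivity) (by
          intro t ht
          have hm : (y₀.1, y₀.2 + t • d) ∈ Metric.ball y₀ r := by
            have : ((y₀.1, y₀.2 + t • d) : Vec3 × Vec3) = y₀ + (0, t • d) := by ext <;> simp
            rw [this, mem_ball_iff_norm, add_sub_cancel_left, Prod.norm_mk, norm_zero,
              norm_smul, Real.norm_eq_abs, max_eq_right (by positivity)]
            rw [lt_div_iff₀ hd] at ht
            nlinarith [abs_nonneg t]
          have h1 := congrFun (hpar _ hm) k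
          rw [haff _ hm] at h1
          simp at h1
          simp
          linarith)
      exact ⟨this.2.2, this.2.1⟩
    exact ⟨funext fun k => (key k).1, funext fun k => (key k).2⟩
  refine eq_zero_of_cross_affine M (fun d => (hpoly d).1) (fun d => (hpoly d).2) ?_
  have comp : ∀ {f : Vec3 × Vec3 → Vec3}, ContDiffAt ℝ ∞ f y₀ → ∀ k a,
      fderiv ℝ (fun y => f y k) y₀ a = fderiv ℝ f y₀ a k := fun hf k a =>
    congrArg (fun L => L a) (hasFDerivAt_pi'.1 (hf.differentiableAt (by simp)).hasFDerivAt k).fderiv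
  -- The trace of M involves only off-diagonal entries of ∂w/∂u. Replaced by -∂v/∂x, they leave an
  -- antisymmetric sum of second x-derivatives of v, which is zero.
  have hmix : ∀ s i k, k ≠ s → fderiv ℝ (fun y => fderiv ℝ w y (0, Pi.single s 1)) y₀
      (Pi.single i 1, 0) k =
      -fderiv ℝ (fun y => fderiv ℝ v y (Pi.single s 1, 0)) y₀ (Pi.single i 1, 0) k := by
    intro s i k hks
    have h1 : (fun y => fderiv ℝ w y (0, Pi.single s 1) k) =ᶠ[nhds y₀]
        fun y => -fderiv ℝ v y (Pi.single s 1, 0) k := by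
      filter_upwards [hopen.mem_nhds h0] with y' hy'
      exact hvw y' hy' k s hks
    rw [← comp (contDiffAt_fderiv_apply (hw y₀ h0) _), h1.fderiv_eq, fderiv_fun_neg,
      neg_apply, comp (contDiffAt_fderiv_apply (hv y₀ h0) _)]
  have hsym := fun a b => fderiv_fderiv_apply_comm (hv y₀ h0) (Pi.single a 1, 0) (Pi.single b 1, 0)
  simp only [hM, fderiv_curlX (hw y₀ h0), curlX, curlL_eq, Fin.sum_univ_three]
  simp [hmix, hsym 1 0, hsym 2 0, hsym 2 1]
  ring

theorem quadGrad_eq_of_linear {v w : Vec3 × Vec3 → Vec3} (y : Vec3 × Vec3) (p : Grad3) (k i : Fin 3) :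
    (mv p (fderiv ℝ v y (Pi.single i 1, fun k => p k i)) +
      fderiv ℝ w y (Pi.single i 1, fun k => p k i)) k =
    quadGrad (fun k i => fderiv ℝ v y (Pi.single i 1, 0) k)
      (fun k m => fderiv ℝ v y (0, Pi.single m 1) k)
      (fun k i => fderiv ℝ w y (Pi.single i 1, 0) k)
      (fun k m => fderiv ℝ w y (0, Pi.single m 1) k) p k i := by
  have h : ((Pi.single i 1, fun k => p k i) : Vec3 × Vec3) =
      (Pi.single i 1, 0) + ∑ m, p m i • ((0, Pi.single m 1) : Vec3 × Vec3) := by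
    have := sum_smul_single fun k => p k i
    ext1
    · simp [Fin.sum_univ_three]
    · conv_lhs => rw [this]
      simp [Fin.sum_univ_three]
  have hf : ∀ f : Vec3 × Vec3 → Vec3, fderiv ℝ f y (Pi.single i 1, fun k => p k i) =
      fderiv ℝ f y (Pi.single i 1, 0) + ∑ m, p m i • fderiv ℝ f y (0, Pi.single m 1) := by
    intro f
    rw [h, map_add, map_sum]
    simp only [map_smul]
  rw [hf, hf]
  simp [quadGrad, mm_apply, mv_apply, Fin.sum_univ_three]
  ring

/-! ### Vanishing of α -/

theorem alpha_eq_zero_of_ne_zero {U : Set Jet1} (hU : IsOpen U) {α : Vec3 → Grad3 → ℝ}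
    {X : InfOp} (hX : X.SmoothOn U) (h : ModifiedDetermining U vacuumSys (forceFreeRhs α) X)
    {x u : Vec3} {s : Fin 5 → ℝ} (hj : (x, u, stf s) ∈ U) (hu : u ≠ 0) : α u (stf s) = 0 := by
  obtain ⟨r, hr, hball⟩ : ∃ r > 0, Metric.ball ((x, u), s) r ⊆
      vacChart ⁻¹' U ∩ {z | z.1.2 ≠ 0} := by
    refine Metric.isOpen_iff.1 ((hU.preimage vacChart.continuous).inter ?_) _ ⟨hj, hu⟩
    exact isOpen_ne_fun continuous_fst.snd continuous_const
  obtain ⟨Q, hQ⟩ : ∃ Q : (Vec3 × Vec3) × (Fin 5 → ℝ) → Vec3,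
    Q = fun z => X.charac (vacChart z) := ⟨_, rfl⟩
  have hc : ∀ z ∈ Metric.ball ((x, u), s) r, ContDiffAt ℝ ∞ X.charac (vacChart z) :=
    fun z hz => hX.contDiffAt_charac hU (hball hz).1
  have hQs : ∀ z ∈ Metric.ball ((x, u), s) r, ContDiffAt ℝ ∞ Q z := fun z hz => by
    rw [hQ]; exact (hc z hz).comp z vacChart.contDiff.contDiffAt
  have hdet : ∀ z ∈ Metric.ball ((x, u), s) r, ∀ t,
      curlL (fun k i => fderiv ℝ Q z ((Pi.single i 1, fun k => stf z.2 k i),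
        stfCoord fun a b => harm t a b i) k) = α z.1.2 (stf z.2) • z.1.2 ∧
      divL (fun k i => fderiv ℝ Q z ((Pi.single i 1, fun k => stf z.2 k i),
        stfCoord fun a b => harm t a b i) k) = 0 := by
    intro z hz t
    rw [hQ, ← characGrad_vacJet t (hc z hz)]
    exact h.vacuum hU hX (J := vacJet z t) (hball hz).1 (onSystem_vacJet z t)
  have hsplit : ∀ z t, (fun k i => fderiv ℝ Q z ((Pi.single i 1, fun k => stf z.2 k i),
      stfCoord fun a b => harm t a b i) k : Grad3) =
      (fun k i => fderiv ℝ Q z ((Pi.single i 1, fun k => stf z.2 k i),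
        stfCoord fun a b => harm 0 a b i) k) +
      fun k i => fderiv ℝ Q z (0, stfCoord fun a b => harm t a b i) k := by
    intro z t
    ext k i
    rw [Pi.add_apply, Pi.add_apply, ← Pi.add_apply, ← map_add, stfCoord_harm_zero]
    simp
  obtain ⟨v, w, hv, hw, hvw⟩ := exists_eq_mv_stf_add hQs fun z hz => by
    have h0 := hdet z hz 0
    -- The right-hand side does not involve the second derivatives, so the harmonic part has no curl
    -- in any direction and any nonzero vector serves.
    refine ⟨fun _ => 1, fun h => one_ne_zero (congrFun h 0), fun t => ?_, fun t => ?_⟩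
    · have h1 := (hdet z hz t).2
      rw [hsplit, map_add, h0.2, zero_add] at h1
      exact h1
    · have h1 := (hdet z hz t).1
      rw [hsplit, map_add, h0.1, add_eq_left] at h1
      rw [← curlL_apply, h1]; simp
  have hmem : ∀ y ∈ Metric.ball (x, u) r, ∀ c ∈ Metric.ball s r,
      (y, c) ∈ Metric.ball ((x, u), s) r := by
    intro y hy c hc
    rw [← ball_prod_same]; exact ⟨hy, hc⟩
  have hs : s ∈ Metric.ball s r := Metric.mem_ball_self hr
  have hgrad : ∀ y ∈ Metric.ball (x, u) r, ∀ c ∈ Metric.ball s r,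
      curlL (quadGrad (fun k i => fderiv ℝ v y (Pi.single i 1, 0) k)
        (fun k m => fderiv ℝ v y (0, Pi.single m 1) k)
        (fun k i => fderiv ℝ w y (Pi.single i 1, 0) k)
        (fun k m => fderiv ℝ w y (0, Pi.single m 1) k) (stf c)) = α y.2 (stf c) • y.2 ∧
      divL (quadGrad (fun k i => fderiv ℝ v y (Pi.single i 1, 0) k)
        (fun k m => fderiv ℝ v y (0, Pi.single m 1) k)
        (fun k i => fderiv ℝ w y (Pi.single i 1, 0) k)
        (fun k m => fderiv ℝ w y (0, Pi.single m 1) k) (stf c)) = 0 := by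
    intro y hy c hcb
    have h1 := hdet _ (hmem y hy c hcb) 0
    have h2 : Q =ᶠ[nhds (y, c)] fun z => mv (stf z.2) (v z.1) + w z.1 := by
      filter_upwards [Metric.isOpen_ball.mem_nhds (hmem y hy c hcb)] with z hz
      rw [← ball_prod_same] at hz
      exact hvw z.1 hz.1 z.2 hz.2
    have h3 := fderiv_mv_stf_add h2 ((hv y hy).differentiableAt (by simp))
      ((hw y hy).differentiableAt (by simp))
    simp only [stfCoord_harm_zero, h3, map_zero, zero_apply, zero_add, quadGrad_eq_of_linear] at h1
    exact h1
  have hconf : ∀ y ∈ Metric.ball (x, u) r, (∀ d, fderiv ℝ v y (0, d) = 0) ∧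
      (∀ k l, k ≠ l → fderiv ℝ w y (0, Pi.single l 1) k = -fderiv ℝ v y (Pi.single l 1, 0) k) ∧
      (∀ k l, fderiv ℝ w y (0, Pi.single k 1) k = fderiv ℝ w y (0, Pi.single l 1) l) ∧
      curlX w y = α y.2 (stf s) • y.2 := by
    intro y hy
    have hy2 : y.2 ≠ 0 := (hball (hmem y hy s hs)).2
    have hg := hgrad y hy
    obtain ⟨A, hA⟩ : ∃ A : Grad3, A = fun k i => fderiv ℝ v y (Pi.single i 1, 0) k := ⟨_, rfl⟩
    obtain ⟨V, hV⟩ : ∃ V : Grad3, V = fun k m => fderiv ℝ v y (0, Pi.single m 1) k := ⟨_, rfl⟩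
    obtain ⟨Z, hZ⟩ : ∃ Z : Grad3, Z = fun k i => fderiv ℝ w y (Pi.single i 1, 0) k := ⟨_, rfl⟩
    obtain ⟨W, hW⟩ : ∃ W : Grad3, W = fun k m => fderiv ℝ w y (0, Pi.single m 1) k := ⟨_, rfl⟩
    rw [← hA, ← hV, ← hZ, ← hW] at hg
    -- The cross product with the field eliminates α, whose dependence on s is arbitrary.
    have hcross : ∀ c ∈ Metric.ball s r,
        crossL.flip y.2 (curlL (quadGrad A V Z W (stf c + 0))) = 0 := by
      intro c hcb
      rw [add_zero, (hg c hcb).1, map_smul, ContinuousLinearMap.flip_apply, crossL_apply,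
        cross_self, smul_zero]
    have e1 := quadGrad_coeff (X := A) (V := V) (Z := Z) (W := W) (p := 0) divL hr
      fun c hcb => by rw [add_zero]; exact (hg c hcb).2
    have e2 := fun k => quadGrad_coeff (X := A) (V := V) (Z := Z) (W := W) (p := 0)
      ((ContinuousLinearMap.proj k).comp ((crossL.flip y.2).comp curlL)) hr
      fun c hcb => congrFun (hcross c hcb) k
    have hV0 : V = 0 := eq_zero_of_cross_curlL_eq_zero hy2 (fun c => (e1 c).2)
      fun c => funext fun k => (e2 k c).2
    have hlin := conformal_of_linear_part (X := A) (W := W) hy2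
      (fun c => by simpa [hV0] using (e1 c).1)
      (fun c => funext fun k => by simpa [hV0] using (e2 k c).1)
    refine ⟨fun d => ?_, fun k l hkl => ?_, fun k l => ?_, ?_⟩
    · have hd : ((0, d) : Vec3 × Vec3) = ∑ m, d m • ((0, Pi.single m 1) : Vec3 × Vec3) := by
        conv_lhs => rw [sum_smul_single d]
        simp [Fin.sum_univ_three]
      rw [hd, map_sum]
      refine Finset.sum_eq_zero fun m _ => ?_
      rw [map_smul]
      have : fderiv ℝ v y (0, Pi.single m 1) = 0 := by
        ext k
        rw [hV] at hV0
        exact congrFun (congrFun hV0 k) m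
      rw [this, smul_zero]
    · have := hlin.2.1 k l hkl
      rwa [hW, hA] at this
    · have := hlin.2.2 k l
      rwa [hW] at this
    · have h1 := (hg s hs).1
      have h2 := hlin.1 s
      rw [map_add] at h2
      rw [curlX, ← hZ, ← h1, quadGrad, hV0]
      simp only [zero_apply, map_zero, add_zero, map_add]
      rw [add_right_comm, h2, zero_add]
  have hy0 : (x, u) ∈ Metric.ball (x, u) r := Metric.mem_ball_self hr
  have hz := curlX_eq_zero hr hv hw (fun y hy => (hconf y hy).1) (fun y hy => (hconf y hy).2.1)
    (fun y hy => (hconf y hy).2.2.1) (fun y hy => by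
      rw [(hconf y hy).2.2.2, map_smul, crossL_apply, cross_self, smul_zero])
  rw [(hconf _ hy0).2.2.2] at hz
  exact (smul_eq_zero.1 hz).resolve_right hu

theorem alpha_eq_zero {U : Set Jet1} (hU : IsOpen U) {α : Vec3 → Grad3 → ℝ}
    (hα : ContDiffOn ℝ ∞ (fun j : Jet1 => α j.2.1 j.2.2) U)
    {X : InfOp} (hX : X.SmoothOn U) (h : ModifiedDetermining U vacuumSys (forceFreeRhs α) X)
    {j : Jet1} (hj : j ∈ U) (hs : vacuumSys j = 0) : α j.2.1 j.2.2 = 0 := by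
  have hp : j.2.2 = stf (stfCoord j.2.2) := by
    have h1 : curlJet j.2.2 = 0 ∧ divJet j.2.2 = 0 := Prod.mk.injEq .. ▸ hs
    have := eq_stf_add_rot h1.2
    rwa [h1.1, map_zero, smul_zero, add_zero] at this
  by_cases hu : j.2.1 = 0
  -- The vacuum equations do not involve u, so the jet with u = 0 is a limit of vacuum jets with the
  -- same first derivatives and u = t e₀ ≠ 0.
  · have hcont : Continuous fun t : ℝ => ((j.1, t • Pi.single 0 1, j.2.2) : Jet1) := by fun_prop
    have h0 : ((j.1, (0 : ℝ) • Pi.single 0 1, j.2.2) : Jet1) = j := by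
      rw [zero_smul, ← hu]
    have hca := (hα.continuousOn.continuousAt (hU.mem_nhds hj))
    rw [← h0] at hca
    have hlim := (hca.comp (f := fun t : ℝ => ((j.1, t • Pi.single 0 1, j.2.2) : Jet1))
      hcont.continuousAt).tendsto.mono_left (nhdsWithin_le_nhds (s := {0}ᶜ))
    have hev : ∀ᶠ t : ℝ in nhdsWithin 0 {0}ᶜ, ((j.1, t • Pi.single 0 1, j.2.2) : Jet1) ∈ U :=
      nhdsWithin_le_nhds (hcont.continuousAt.preimage_mem_nhds
        (hU.mem_nhds (by rw [h0]; exact hj)))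
    have hzero := hlim.congr' (f₂ := fun _ => (0 : ℝ)) (by
      filter_upwards [hev, self_mem_nhdsWithin] with t ht ht0
      simp only [Function.comp_apply]
      rw [hp] at ht ⊢
      refine alpha_eq_zero_of_ne_zero hU hX h ht fun h' => ht0 ?_
      simpa using congrFun h' 0)
    have := tendsto_nhds_unique hzero tendsto_const_nhds
    simpa [hu] using this
  · rw [hp]
    refine alpha_eq_zero_of_ne_zero hU hX h (x := j.1) ?_ hu
    rw [← hp]; exact hj

/-! ### Jets of force-free fields -/

theorem stfCoord_add (p q : Grad3) : stfCoord (p + q) = stfCoord p + stfCoord q := by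
  ext a
  fin_cases a <;> simp [stfCoord] <;> ring

/-- An array of second derivatives, symmetric and divergence-free, whose curl has the given
trace-free gradient. -/
noncomputable def ofCurlGrad (C : Grad3) (k l i : Fin 3) : ℝ :=
  (rot (fun s => C s i) k l + rot (fun s => C s l) k i) / 3 -
    ((if k = l then curlL C i else 0) + (if l = i then curlL C k else 0) +
      (if i = k then curlL C l else 0)) / 15

theorem ofCurlGrad_symm (C : Grad3) (k l i : Fin 3) : ofCurlGrad C k l i = ofCurlGrad C k i l := by
  simp only [ofCurlGrad, eq_comm (a := k), eq_comm (a := i) (b := l)]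
  ring

theorem curlL_ofCurlGrad {C : Grad3} (hC : divL C = 0) (i : Fin 3) :
    curlL (fun k l => ofCurlGrad C k l i) = fun s => C s i := by
  rw [divL_eq] at hC
  ext s
  -- The two `rot` terms have curls 2C and C - (tr C)·1, which explains the factor 1/3 and the need
  -- for trace zero. The 1/15 term is totally symmetric, so it has no curl; it cancels the
  -- divergence.
  fin_cases i <;> fin_cases s <;> simp [curlL_eq, ofCurlGrad, rot_eq] <;> linarith

theorem divL_ofCurlGrad (C : Grad3) (i : Fin 3) :
    divL (fun k l => ofCurlGrad C k l i) = 0 := by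
  fin_cases i <;> simp [divL_eq, curlL_eq, ofCurlGrad, rot_eq] <;> ring

/-- The jets of force-free fields `u ≠ 0`, in terms of the factor `λ` in `curl u = λ u`. -/
noncomputable def ffChart (z : (Vec3 × Vec3 × ℝ) × (Fin 5 → ℝ)) : Jet1 :=
  (z.1.1, z.1.2.1, stf z.2 + (z.1.2.2 / 2) • rot z.1.2.1)

theorem contDiff_ffChart : ContDiff ℝ ∞ ffChart := by
  have h1 : ContDiff ℝ ∞ fun z : (Vec3 × Vec3 × ℝ) × (Fin 5 → ℝ) => stf z.2 :=
    stf.contDiff.comp contDiff_snd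
  have h2 : ContDiff ℝ ∞ fun z : (Vec3 × Vec3 × ℝ) × (Fin 5 → ℝ) => rot z.1.2.1 :=
    rot.contDiff.comp contDiff_fst.snd.fst
  exact contDiff_fst.fst.prodMk (contDiff_fst.snd.fst.prodMk
    (h1.add ((contDiff_fst.snd.snd.div_const 2).smul h2)))

/-- The derivative of the matrix component of `ffChart`. -/
noncomputable def ffMatDeriv (z : (Vec3 × Vec3 × ℝ) × (Fin 5 → ℝ)) :
    (Vec3 × Vec3 × ℝ) × (Fin 5 → ℝ) →L[ℝ] Grad3 :=
  fderiv ℝ (fun z => (ffChart z).2.2) z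

theorem hasFDerivAt_ffMat (z : (Vec3 × Vec3 × ℝ) × (Fin 5 → ℝ)) :
    HasFDerivAt (fun z => (ffChart z).2.2) (ffMatDeriv z) z :=
  (contDiff_ffChart.snd.snd.differentiable (by simp) z).hasFDerivAt

theorem ffMatDeriv_apply (z d : (Vec3 × Vec3 × ℝ) × (Fin 5 → ℝ)) :
    ffMatDeriv z d = stf d.2 + (d.1.2.2 / 2) • rot z.1.2.1 + (z.1.2.2 / 2) • rot d.1.2.1 := by
  have h1 : HasFDerivAt (fun z : (Vec3 × Vec3 × ℝ) × (Fin 5 → ℝ) => stf z.2)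
      (stf.comp (ContinuousLinearMap.snd ℝ _ _)) z := stf.hasFDerivAt.comp z hasFDerivAt_snd
  have h2 : HasFDerivAt (fun z : (Vec3 × Vec3 × ℝ) × (Fin 5 → ℝ) => z.1.2.1)
      ((ContinuousLinearMap.fst ℝ _ _).comp ((ContinuousLinearMap.snd ℝ _ _).comp
        (ContinuousLinearMap.fst ℝ _ _))) z :=
    ((ContinuousLinearMap.fst ℝ _ _).comp ((ContinuousLinearMap.snd ℝ _ _).comp
        (ContinuousLinearMap.fst ℝ (Vec3 × Vec3 × ℝ) (Fin 5 → ℝ)))).hasFDerivAt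
  have h3 : HasFDerivAt (fun z : (Vec3 × Vec3 × ℝ) × (Fin 5 → ℝ) => z.1.2.2)
      ((ContinuousLinearMap.snd ℝ _ _).comp ((ContinuousLinearMap.snd ℝ _ _).comp
        (ContinuousLinearMap.fst ℝ _ _))) z :=
    ((ContinuousLinearMap.snd ℝ _ _).comp ((ContinuousLinearMap.snd ℝ _ _).comp
        (ContinuousLinearMap.fst ℝ (Vec3 × Vec3 × ℝ) (Fin 5 → ℝ)))).hasFDerivAt
  have h4 := (h1.add ((h3.mul_const (2⁻¹)).smul (rot.hasFDerivAt.comp z h2))).fderiv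
  refine (congrArg (fun L => L d) h4).trans ?_
  simp [div_eq_mul_inv, mul_comm]
  abel

theorem fderiv_ffChart (z d : (Vec3 × Vec3 × ℝ) × (Fin 5 → ℝ)) :
    fderiv ℝ ffChart z d = (d.1.1, d.1.2.1, ffMatDeriv z d) := by
  have h2 : HasFDerivAt (fun z : (Vec3 × Vec3 × ℝ) × (Fin 5 → ℝ) => z.1.2.1)
      ((ContinuousLinearMap.fst ℝ _ _).comp ((ContinuousLinearMap.snd ℝ _ _).comp
        (ContinuousLinearMap.fst ℝ _ _))) z :=
    ((ContinuousLinearMap.fst ℝ _ _).comp ((ContinuousLinearMap.snd ℝ _ _).comp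
        (ContinuousLinearMap.fst ℝ (Vec3 × Vec3 × ℝ) (Fin 5 → ℝ)))).hasFDerivAt
  have h1 : HasFDerivAt (fun z : (Vec3 × Vec3 × ℝ) × (Fin 5 → ℝ) => z.1.1)
      ((ContinuousLinearMap.fst ℝ _ _).comp (ContinuousLinearMap.fst ℝ _ _)) z :=
    ((ContinuousLinearMap.fst ℝ _ _).comp
        (ContinuousLinearMap.fst ℝ (Vec3 × Vec3 × ℝ) (Fin 5 → ℝ))).hasFDerivAt
  have h3 := (h1.prodMk (h2.prodMk (hasFDerivAt_ffMat z))).fderiv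
  exact congrArg (fun L => L d) h3

theorem curlL_ffChart (z : (Vec3 × Vec3 × ℝ) × (Fin 5 → ℝ)) :
    curlL (ffChart z).2.2 = z.1.2.2 • z.1.2.1 := by
  simp only [ffChart]
  rw [← map_smul, curlL_apply, curlJet_stf_add_rot, smul_smul]
  congr 1; ring

theorem divL_ffChart (z : (Vec3 × Vec3 × ℝ) × (Fin 5 → ℝ)) : divL (ffChart z).2.2 = 0 := by
  simp only [ffChart]
  rw [← map_smul, divL_apply, divJet_stf_add_rot]

/-- The gradient of the curl of a force-free field. -/
noncomputable def ffCurlGrad (z : (Vec3 × Vec3 × ℝ) × (Fin 5 → ℝ)) (μ : Vec3) : Grad3 :=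
  z.1.2.2 • (ffChart z).2.2 + fun s i => μ i * z.1.2.1 s

theorem divL_ffCurlGrad (z : (Vec3 × Vec3 × ℝ) × (Fin 5 → ℝ)) {μ : Vec3}
    (hμ : ∑ i, μ i * z.1.2.1 i = 0) : divL (ffCurlGrad z μ) = 0 := by
  rw [ffCurlGrad, map_add, map_smul, divL_ffChart, smul_zero, zero_add, divL_eq,
    ← Fin.sum_univ_three (fun i => μ i * z.1.2.1 i), hμ]

/-- The second-order jets of force-free fields; `μ` is the gradient of the factor `λ`. -/
noncomputable def ffJet (z : (Vec3 × Vec3 × ℝ) × (Fin 5 → ℝ)) (μ : Vec3) (t : Fin 7 → ℝ) :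
    Jet2 where
  base := ffChart z
  h := ofCurlGrad (ffCurlGrad z μ) + harm t
  symm := fun k i l => congrArg₂ (· + ·) (ofCurlGrad_symm _ k i l) (harm_symm t k i l)

theorem curlL_ffJet (z : (Vec3 × Vec3 × ℝ) × (Fin 5 → ℝ)) {μ : Vec3}
    (hμ : ∑ i, μ i * z.1.2.1 i = 0) (t : Fin 7 → ℝ) (i : Fin 3) :
    curlL (fun k l => (ffJet z μ t).h k l i) =
      z.1.2.2 • (fun k => (ffChart z).2.2 k i : Vec3) + μ i • z.1.2.1 := by
  have : (fun k l => (ffJet z μ t).h k l i : Grad3) =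
      (fun k l => ofCurlGrad (ffCurlGrad z μ) k l i) + fun k l => harm t k l i := rfl
  rw [this, map_add, curlL_ofCurlGrad (divL_ffCurlGrad z hμ), curlL_harm, add_zero]
  rfl

theorem divL_ffJet (z : (Vec3 × Vec3 × ℝ) × (Fin 5 → ℝ)) (μ : Vec3) (t : Fin 7 → ℝ) (i : Fin 3) :
    divL (fun k l => (ffJet z μ t).h k l i) = 0 := by
  have : (fun k l => (ffJet z μ t).h k l i : Grad3) =
      (fun k l => ofCurlGrad (ffCurlGrad z μ) k l i) + fun k l => harm t k l i := rfl
  rw [this, map_add, divL_ofCurlGrad, divL_harm, add_zero]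

/-- Differentiating curl u = λu gives curl(∂_i u) = λ∂_i u + μ_i u. The condition μ·u = 0 is div
curl u = 0; crossing with u removes the μ term, and the two λ terms cancel. -/
theorem onSystem_ffJet (z : (Vec3 × Vec3 × ℝ) × (Fin 5 → ℝ)) {μ : Vec3}
    (hμ : ∑ i, μ i * z.1.2.1 i = 0) (t : Fin 7 → ℝ) : OnSystem forceFreeSys (ffJet z μ t) := by
  have hself : ∀ a : Vec3, crossL a a = 0 := fun a => by rw [crossL_apply, cross_self]
  have hb : (ffJet z μ t).base = ffChart z := rfl
  have hu : (ffChart z).2.1 = z.1.2.1 := rfl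
  refine onSystem_forceFreeSys_iff.2 ⟨?_, divL_ffChart z, fun i => ⟨?_, divL_ffJet z μ t i⟩⟩
  · rw [hb, curlL_ffChart, hu, map_smul, smul_apply, hself, smul_zero]
  · rw [hb, curlL_ffJet z hμ, curlL_ffChart, hu]
    simp only [map_add, map_smul, add_apply, smul_apply, hself, smul_zero, add_zero]
    rw [crossL_apply, crossL_apply, ← smul_add, cross_anticomm', smul_zero]

/-- The direction of complete differentiation in the coordinates of `ffChart`. -/
noncomputable def ffDir (z : (Vec3 × Vec3 × ℝ) × (Fin 5 → ℝ)) (μ : Vec3) (t : Fin 7 → ℝ)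
    (i : Fin 3) : (Vec3 × Vec3 × ℝ) × (Fin 5 → ℝ) :=
  ((Pi.single i 1, fun k => (ffChart z).2.2 k i, μ i), stfCoord fun k l => (ffJet z μ t).h k l i)

/-- A divergence-free matrix is determined by its symmetric traceless part and its curl; the chart
coordinates prescribe exactly these two. -/
theorem ffMatDeriv_ffDir (z : (Vec3 × Vec3 × ℝ) × (Fin 5 → ℝ)) {μ : Vec3}
    (hμ : ∑ i, μ i * z.1.2.1 i = 0) (t : Fin 7 → ℝ) (i : Fin 3) :
    ffMatDeriv z (ffDir z μ t i) = fun k l => (ffJet z μ t).h k l i := by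
  have h := eq_stf_add_rot (p := fun k l => (ffJet z μ t).h k l i) (divL_ffJet z μ t i)
  rw [← curlL_apply, curlL_ffJet z hμ] at h
  conv_rhs => rw [h]
  rw [ffMatDeriv_apply, ffDir, map_add, map_smul, map_smul]
  module

theorem ffDir_eq_add (z : (Vec3 × Vec3 × ℝ) × (Fin 5 → ℝ)) (μ : Vec3) (t : Fin 7 → ℝ) (i : Fin 3) :
    ffDir z μ t i = ffDir z μ 0 i + (0, stfCoord fun k l => harm t k l i) := by
  have h1 : (fun k l => (ffJet z μ t).h k l i : Grad3) =
      (fun k l => ofCurlGrad (ffCurlGrad z μ) k l i) + fun k l => harm t k l i := rfl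
  have h2 : (fun k l => (ffJet z μ 0).h k l i : Grad3) =
      (fun k l => ofCurlGrad (ffCurlGrad z μ) k l i) + fun k l => harm 0 k l i := rfl
  rw [ffDir, ffDir, h1, h2, stfCoord_add, stfCoord_add, stfCoord_harm_zero, add_zero]
  simp

theorem fderiv_comp_ffChart {W : Type*} [NormedAddCommGroup W] [NormedSpace ℝ W] {f : Jet1 → W}
    {z : (Vec3 × Vec3 × ℝ) × (Fin 5 → ℝ)} (hf : DifferentiableAt ℝ f (ffChart z)) {μ : Vec3}
    (hμ : ∑ i, μ i * z.1.2.1 i = 0) (t : Fin 7 → ℝ) (i : Fin 3) :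
    fderiv ℝ f (ffChart z) (jetDir (ffJet z μ t) i) =
      fderiv ℝ (fun z => f (ffChart z)) z (ffDir z μ t i) := by
  have h := (hf.hasFDerivAt.comp z
    (contDiff_ffChart.differentiable (by simp) z).hasFDerivAt).fderiv
  rw [Function.comp_def] at h
  rw [h, ContinuousLinearMap.comp_apply, fderiv_ffChart, ffMatDeriv_ffDir z hμ]
  rfl

/-- The modified determining condition in the coordinates of `ffChart`. -/
theorem ModifiedDetermining.forceFree_chart {U : Set Jet1} (hU : IsOpen U) {P : Jet1 → ℝ}
    (hP : ContDiffOn ℝ ∞ P U) {X : InfOp} (hX : X.SmoothOn U)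
    (h : ModifiedDetermining U forceFreeSys (plasmaRhs P) X)
    {z : (Vec3 × Vec3 × ℝ) × (Fin 5 → ℝ)} (hz : ffChart z ∈ U) {μ : Vec3}
    (hμ : ∑ i, μ i * z.1.2.1 i = 0) (t : Fin 7 → ℝ) :
    crossL (curlL fun k i =>
        fderiv ℝ (fun z => X.charac (ffChart z)) z (ffDir z μ t i) k) z.1.2.1 +
      z.1.2.2 • crossL z.1.2.1 (X.charac (ffChart z)) =
      (fun i => fderiv ℝ (fun z => P (ffChart z)) z (ffDir z μ t i)) ∧
      divL (fun k i =>
        fderiv ℝ (fun z => X.charac (ffChart z)) z (ffDir z μ t i) k) = 0 := by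
  have h1 := h.forceFree hU hX (J := ffJet z μ t) hz (onSystem_ffJet z hμ t)
  have hb : (ffJet z μ t).base = ffChart z := rfl
  have hu : (ffChart z).2.1 = z.1.2.1 := rfl
  have hc := (hX.contDiffAt_charac hU hz).differentiableAt (by simp)
  have hPd := (hP.contDiffAt (hU.mem_nhds hz)).differentiableAt (by simp)
  have hG : X.characGrad (ffJet z μ t) = fun k i =>
      fderiv ℝ (fun z => X.charac (ffChart z)) z (ffDir z μ t i) k := by
    ext k i
    rw [← fderiv_comp_ffChart hc hμ]; rfl
  rw [hG, hb, curlL_ffChart, hu, map_smul, smul_apply] at h1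
  refine ⟨h1.1.trans ?_, h1.2⟩
  ext i
  rw [fderiv_comp_ffChart hPd hμ]

/-! ### Dependence of the pressure on the factor alone -/

theorem eq_zero_of_stf_pairing {g u : Vec3} (hu : u ≠ 0)
    (h : ∀ c, ∑ k, g k * mv (stf c) u k = 0) : g = 0 := by
  -- The test matrix is the symmetric traceless part of g ⊗ u, so the pairing is its squared norm.
  have h1 := h ![g 0 * u 0 - (g 0 * u 0 + g 1 * u 1 + g 2 * u 2) / 3,
    g 1 * u 1 - (g 0 * u 0 + g 1 * u 1 + g 2 * u 2) / 3, (g 0 * u 1 + g 1 * u 0) / 2,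
    (g 0 * u 2 + g 2 * u 0) / 2, (g 1 * u 2 + g 2 * u 1) / 2]
  simp [Fin.sum_univ_three, mv_apply, stf_eq] at h1
  have hu' := sq_pos_of_ne_zero hu
  have h2 : (g 0 ^ 2 + g 1 ^ 2 + g 2 ^ 2) * (u 0 ^ 2 + u 1 ^ 2 + u 2 ^ 2) +
      (g 0 * u 0 + g 1 * u 1 + g 2 * u 2) ^ 2 / 3 = 0 := by
    linear_combination 2 * h1
  have h3 : 0 ≤ (g 0 ^ 2 + g 1 ^ 2 + g 2 ^ 2) * (u 0 ^ 2 + u 1 ^ 2 + u 2 ^ 2) := by positivity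
  have h4 := sq_nonneg (g 0 * u 0 + g 1 * u 1 + g 2 * u 2)
  have h5 : (g 0 ^ 2 + g 1 ^ 2 + g 2 ^ 2) * (u 0 ^ 2 + u 1 ^ 2 + u 2 ^ 2) = 0 := by linarith
  exact vec_eq_zero_of_sq ((mul_eq_zero.1 h5).resolve_right hu'.ne')

theorem exists_orthogonal (u : Vec3) : ∃ n : Vec3, n ≠ 0 ∧ ∑ i, n i * u i = 0 := by
  by_cases h : u 0 = 0 ∧ u 1 = 0
  · refine ⟨Pi.single 0 1, fun h' => one_ne_zero (α := ℝ) (by simpa using congrFun h' 0), ?_⟩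
    simp [Fin.sum_univ_three, h.1]
  · refine ⟨![u 1, -u 0, 0], fun h' => h ?_, ?_⟩
    · have h0 := congrFun h' 0
      have h1 := congrFun h' 1
      simp at h0 h1
      exact ⟨h1, h0⟩
    · simp [Fin.sum_univ_three]; ring

theorem exists_smul_add_mem_ball {S : Type*} [NormedAddCommGroup S] [NormedSpace ℝ S] {s₀ : S}
    {r : ℝ} (hr : 0 < r) (c : S) : ∃ ε : ℝ, 0 < ε ∧ s₀ + ε • c ∈ Metric.ball s₀ r := by
  have hc : 0 < ‖c‖ + 1 := by positivity
  refine ⟨r / (‖c‖ + 1), by positivity, ?_⟩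
  rw [mem_ball_iff_norm, add_sub_cancel_left, norm_smul, Real.norm_eq_abs,
    abs_of_pos (by positivity), div_mul_eq_mul_div, div_lt_iff₀ hc]
  nlinarith

theorem mv_ffChart_self (z : (Vec3 × Vec3 × ℝ) × (Fin 5 → ℝ)) :
    mv (ffChart z).2.2 z.1.2.1 = mv (stf z.2) z.1.2.1 := by
  simp only [ffChart, map_add, map_smul, add_apply, smul_apply]
  have : mv (rot z.1.2.1) z.1.2.1 = 0 := by
    ext k
    fin_cases k <;> simp [mv_apply, rot_eq] <;> ring
  rw [this, smul_zero, add_zero]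

/-- The pressure depends on the factor `λ` only. -/
theorem pressure_depends_on_factor {P : (Vec3 × Vec3 × ℝ) × (Fin 5 → ℝ) → ℝ}
    {y₀ : Vec3 × Vec3 × ℝ} {s₀ : Fin 5 → ℝ} {r : ℝ} (hr : 0 < r)
    (hP : ∀ z ∈ Metric.ball (y₀, s₀) r, ContDiffAt ℝ ∞ P z)
    (hu : ∀ y ∈ Metric.ball y₀ r, y.2.1 ≠ 0)
    (h : ∀ z ∈ Metric.ball (y₀, s₀) r, ∀ t,
      ∑ i, z.1.2.1 i * fderiv ℝ P z (ffDir z 0 t i) = 0) :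
    ∃ p : Vec3 × Vec3 × ℝ → ℝ, (∀ y ∈ Metric.ball y₀ r, ContDiffAt ℝ ∞ p y) ∧
      (∀ z ∈ Metric.ball (y₀, s₀) r, P z = p z.1) ∧
      ∀ y ∈ Metric.ball y₀ r, ∀ a b, fderiv ℝ p y (a, b, 0) = 0 := by
  have hmem : ∀ y ∈ Metric.ball y₀ r, ∀ s ∈ Metric.ball s₀ r, (y, s) ∈ Metric.ball (y₀, s₀) r := by
    intro y hy s hs
    rw [← ball_prod_same]; exact ⟨hy, hs⟩
  have hs₀ : s₀ ∈ Metric.ball s₀ r := Metric.mem_ball_self hr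
  have hzmem : ∀ z ∈ Metric.ball (y₀, s₀) r, z.1 ∈ Metric.ball y₀ r ∧ z.2 ∈ Metric.ball s₀ r := by
    intro z hz
    rw [← ball_prod_same] at hz; exact hz
  have hs : ∀ z ∈ Metric.ball (y₀, s₀) r, ∀ c, fderiv ℝ P z (0, c) = 0 := by
    intro z hz
    obtain ⟨L, hL⟩ : ∃ L : (Fin 5 → ℝ) →ₗ[ℝ] ℝ, ∀ c, L c = fderiv ℝ P z (0, c) :=
      ⟨(fderiv ℝ P z).toLinearMap ∘ₗ LinearMap.inr ℝ _ (Fin 5 → ℝ), fun c => rfl⟩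
    have hLs : ∀ c, L c = ∑ a, L (Pi.single a 1) * c a := by
      intro c
      conv_lhs => rw [pi_eq_sum_univ' c]
      simp [mul_comm]
    have hz0 : (fun a => L (Pi.single a 1)) = 0 := by
      refine eq_zero_of_harm_contract (hu _ (hzmem z hz).1) fun t => ?_
      have h1 := h z hz t
      have h0 := h z hz 0
      simp only [ffDir_eq_add z 0 t, map_add, mul_add, Finset.sum_add_distrib, h0, zero_add] at h1
      refine (Finset.sum_congr rfl fun i _ => ?_).trans h1
      rw [← hL, hLs]
    intro c
    rw [← hL, hLs]
    exact Finset.sum_eq_zero fun a _ => by rw [congrFun hz0 a, Pi.zero_apply, zero_mul]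
  have hPp : ∀ z ∈ Metric.ball (y₀, s₀) r, P z = P (z.1, s₀) := by
    intro z hz
    refine eq_of_fderiv_apply_sub_eq_zero (convex_ball _ _)
      (fun z' hz' => (hP z' hz').differentiableAt (by simp)) hz
      (hmem _ (hzmem z hz).1 _ hs₀) fun z' hz' => ?_
    have : (z.1, s₀) - z = (0, s₀ - z.2) := by ext <;> simp
    rw [this, hs z' hz']
  obtain ⟨p, hp⟩ : ∃ p : Vec3 × Vec3 × ℝ → ℝ, p = fun y => P (y, s₀) := ⟨_, rfl⟩
  have hps : ∀ y ∈ Metric.ball y₀ r, ContDiffAt ℝ ∞ p y := fun y hy => by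
    rw [hp]
    exact (hP _ (hmem y hy s₀ hs₀)).comp y (contDiffAt_id.prodMk contDiffAt_const)
  have hfd : ∀ z ∈ Metric.ball (y₀, s₀) r, ∀ d, fderiv ℝ P z d = fderiv ℝ p z.1 d.1 := by
    intro z hz d
    have he : P =ᶠ[nhds z] fun z => p z.1 := by
      filter_upwards [Metric.isOpen_ball.mem_nhds hz] with z' hz'
      rw [hPp z' hz', hp]
    have h1 : HasFDerivAt (fun z : (Vec3 × Vec3 × ℝ) × (Fin 5 → ℝ) => z.1)
      (ContinuousLinearMap.fst ℝ _ _) z := hasFDerivAt_fst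
    rw [he.fderiv_eq]
    exact congrArg (fun L => L d)
      (((hps z.1 (hzmem z hz).1).differentiableAt (by simp)).hasFDerivAt.comp z h1).fderiv
  -- In u·grad p the antisymmetric part of u₁ drops out, since u × u = 0; only `stf s` acts on u.
  have hflow : ∀ y ∈ Metric.ball y₀ r, ∀ s ∈ Metric.ball s₀ r,
      fderiv ℝ p y (y.2.1, mv (stf s) y.2.1, 0) = 0 := by
    intro y hy s hsb
    have h1 := h _ (hmem y hy s hsb) 0
    have h2 : ((y.2.1, mv (stf s) y.2.1, 0) : Vec3 × Vec3 × ℝ) =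
        ∑ i, y.2.1 i • (Pi.single i 1, (fun k => (ffChart (y, s)).2.2 k i : Vec3), (0 : ℝ)) := by
      have h3 := mv_ffChart_self (y, s)
      ext1
      · conv_lhs => rw [sum_smul_single y.2.1]
        simp [Fin.sum_univ_three]
      · ext1
        · rw [← h3]
          ext k
          simp [mv_apply, Fin.sum_univ_three]
          ring
        · simp [Fin.sum_univ_three]
    rw [h2, map_sum]
    refine Eq.trans ?_ h1
    refine Finset.sum_congr rfl fun i _ => ?_
    rw [map_smul, hfd _ (hmem y hy s hsb)]
    rfl
  have hfield : ∀ y ∈ Metric.ball y₀ r, ∀ b, fderiv ℝ p y (0, b, 0) = 0 := by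
    intro y hy
    have h1 : ∀ c, fderiv ℝ p y (0, mv (stf c) y.2.1, 0) = 0 := by
      intro c
      obtain ⟨ε, hε, hm⟩ := exists_smul_add_mem_ball hr (s₀ := s₀) c
      have h2 := hflow y hy _ hm
      have h3 := hflow y hy _ hs₀
      have h4 : ((y.2.1, mv (stf (s₀ + ε • c)) y.2.1, 0) : Vec3 × Vec3 × ℝ) =
          (y.2.1, mv (stf s₀) y.2.1, 0) + ε • (0, mv (stf c) y.2.1, 0) := by
        ext1
        · simp
        · simp
      rw [h4, map_add, h3, zero_add, map_smul] at h2
      exact (smul_eq_zero.1 h2).resolve_left hε.ne'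
    obtain ⟨L, hL⟩ : ∃ L : Vec3 →ₗ[ℝ] ℝ, ∀ b, L b = fderiv ℝ p y (0, b, 0) :=
      ⟨(fderiv ℝ p y).toLinearMap ∘ₗ LinearMap.inr ℝ Vec3 (Vec3 × ℝ) ∘ₗ LinearMap.inl ℝ Vec3 ℝ,
        fun c => rfl⟩
    have hLs : ∀ c, L c = ∑ a, L (Pi.single a 1) * c a := by
      intro c
      conv_lhs => rw [pi_eq_sum_univ' c]
      simp [mul_comm]
    have hz0 : (fun a => L (Pi.single a 1)) = 0 := by
      refine eq_zero_of_stf_pairing (hu y hy) fun c => ?_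
      rw [← hLs, hL, h1]
    intro b
    rw [← hL, hLs]
    exact Finset.sum_eq_zero fun a _ => by rw [congrFun hz0 a, Pi.zero_apply, zero_mul]
  refine ⟨p, hps, fun z hz => by rw [hPp z hz, hp], fun y hy a b => ?_⟩
  -- With ∂p/∂u = 0 the flow equation reads u·∂p/∂x = 0 for all nearby u; its u-derivative in the
  -- direction a gives the claim, as the mixed derivatives vanish.
  have hx : fderiv ℝ p y (a, 0, 0) = 0 := by
    obtain ⟨N, hN⟩ : ∃ N : Vec3 × Vec3 × ℝ →L[ℝ] Vec3 × Vec3 × ℝ, ∀ y, N y = (y.2.1, 0, 0) :=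
      ⟨(ContinuousLinearMap.inl ℝ Vec3 (Vec3 × ℝ)).comp ((ContinuousLinearMap.fst ℝ Vec3 ℝ).comp
        (ContinuousLinearMap.snd ℝ Vec3 (Vec3 × ℝ))), fun y => rfl⟩
    have h0 : (fun y => fderiv ℝ p y (N y)) =ᶠ[nhds y] fun _ => 0 := by
      filter_upwards [Metric.isOpen_ball.mem_nhds hy] with y' hy'
      have h1 := hflow y' hy' s₀ hs₀
      have h2 : ((y'.2.1, mv (stf s₀) y'.2.1, 0) : Vec3 × Vec3 × ℝ) =
          N y' + (0, mv (stf s₀) y'.2.1, 0) := by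
        rw [hN]; simp
      rwa [h2, map_add, hfield y' hy', add_zero] at h1
    have hd : DifferentiableAt ℝ (fderiv ℝ p) y :=
      ((hps y hy).fderiv_right (m := ∞) (by simp)).differentiableAt (by simp)
    have h1 := (hd.hasFDerivAt.clm_apply N.hasFDerivAt).fderiv
    rw [h0.fderiv_eq] at h1
    have h2 := congrArg (fun L => L (0, a, 0)) h1
    have h3 : fderiv ℝ (fderiv ℝ p) y (0, a, 0) (N y) = 0 := by
      have hs : IsSymmSndFDerivAt ℝ p y := (hps y hy).isSymmSndFDerivAt (by
        simp only [minSmoothness_of_isRCLikeNormedField]; exact WithTop.coe_le_coe.2 le_top)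
      have he : (fun y => fderiv ℝ p y (0, a, 0)) =ᶠ[nhds y] fun _ => 0 := by
        filter_upwards [Metric.isOpen_ball.mem_nhds hy] with y' hy'
        exact hfield y' hy' a
      have h4 := (hd.hasFDerivAt.clm_apply (hasFDerivAt_const (0, a, 0) y)).fderiv
      rw [he.fderiv_eq] at h4
      have h5 := congrArg (fun L => L (N y)) h4
      rw [hs]
      simpa using h5.symm
    rw [hN] at h3
    simp [hN, h3] at h2
    exact h2.symm
  have : ((a, b, 0) : Vec3 × Vec3 × ℝ) = (a, 0, 0) + (0, b, 0) := by simp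
  rw [this, map_add, hx, hfield y hy, add_zero]

/-! ### Reduced determining conditions for force-free fields -/

/-- The part of the gradient of a characteristic `p v + w` that contains no second derivatives. -/
noncomputable def reducedGrad (v w : Vec3 × Vec3 × ℝ → Vec3)
    (z : (Vec3 × Vec3 × ℝ) × (Fin 5 → ℝ)) (μ : Vec3) : Grad3 := fun k i =>
  (mv (ffChart z).2.2 (fderiv ℝ v z.1 (Pi.single i 1, fun k => (ffChart z).2.2 k i, μ i)) +
    fderiv ℝ w z.1 (Pi.single i 1, fun k => (ffChart z).2.2 k i, μ i)) k

theorem fderiv_mv_ffChart_add {Q : (Vec3 × Vec3 × ℝ) × (Fin 5 → ℝ) → Vec3}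
    {v w : Vec3 × Vec3 × ℝ → Vec3} {z : (Vec3 × Vec3 × ℝ) × (Fin 5 → ℝ)}
    (hQ : Q =ᶠ[nhds z] fun z => mv (ffChart z).2.2 (v z.1) + w z.1)
    (hv : DifferentiableAt ℝ v z.1) (hw : DifferentiableAt ℝ w z.1)
    (d : (Vec3 × Vec3 × ℝ) × (Fin 5 → ℝ)) :
    fderiv ℝ Q z d = mv (ffMatDeriv z d) (v z.1) + mv (ffChart z).2.2 (fderiv ℝ v z.1 d.1) +
      fderiv ℝ w z.1 d.1 := by
  have h1 : HasFDerivAt (fun z : (Vec3 × Vec3 × ℝ) × (Fin 5 → ℝ) => z.1)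
    (ContinuousLinearMap.fst ℝ _ _) z := hasFDerivAt_fst
  have h2 := (mv.hasFDerivAt.comp z (hasFDerivAt_ffMat z)).clm_apply (hv.hasFDerivAt.comp z h1)
  have h3 := (h2.add (hw.hasFDerivAt.comp z h1)).fderiv
  rw [hQ.fderiv_eq]
  refine (congrArg (fun L => L d) h3).trans ?_
  simp [add_comm]

/-- Near a force-free jet with `u ≠ 0` the characteristic is affine in the first derivatives. -/
theorem exists_reduction {U : Set Jet1} (hU : IsOpen U) {P : Jet1 → ℝ}
    (hP : ContDiffOn ℝ ∞ P U) {X : InfOp} (hX : X.SmoothOn U)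
    (h : ModifiedDetermining U forceFreeSys (plasmaRhs P) X)
    {y₀ : Vec3 × Vec3 × ℝ} {s₀ : Fin 5 → ℝ} (hz₀ : ffChart (y₀, s₀) ∈ U) (hu₀ : y₀.2.1 ≠ 0) :
    ∃ r > 0, ∃ (v w : Vec3 × Vec3 × ℝ → Vec3) (p : Vec3 × Vec3 × ℝ → ℝ),
      (∀ y ∈ Metric.ball y₀ r, y.2.1 ≠ 0) ∧
      (∀ y ∈ Metric.ball y₀ r, ContDiffAt ℝ ∞ v y) ∧
      (∀ y ∈ Metric.ball y₀ r, ContDiffAt ℝ ∞ w y) ∧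
      (∀ y ∈ Metric.ball y₀ r, ContDiffAt ℝ ∞ p y) ∧
      (∀ z ∈ Metric.ball (y₀, s₀) r, P (ffChart z) = p z.1) ∧
      (∀ y ∈ Metric.ball y₀ r, ∀ a b, fderiv ℝ p y (a, b, 0) = 0) ∧
      ∀ y ∈ Metric.ball y₀ r, ∀ s ∈ Metric.ball s₀ r, ∀ μ : Vec3, ∑ i, μ i * y.2.1 i = 0 →
        crossL (curlL (reducedGrad v w (y, s) μ)) y.2.1 + y.2.2 • crossL y.2.1 (w y) =
          fderiv ℝ p y (0, 0, 1) • μ ∧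
        divL (reducedGrad v w (y, s) μ) = 0 := by
  obtain ⟨r, hr, hball⟩ : ∃ r > 0, Metric.ball (y₀, s₀) r ⊆
      ffChart ⁻¹' U ∩ {z | z.1.2.1 ≠ 0} := by
    refine Metric.isOpen_iff.1 ((hU.preimage contDiff_ffChart.continuous).inter ?_) _ ⟨hz₀, hu₀⟩
    exact isOpen_ne_fun continuous_fst.snd.fst continuous_const
  have hmem : ∀ y ∈ Metric.ball y₀ r, ∀ s ∈ Metric.ball s₀ r, (y, s) ∈ Metric.ball (y₀, s₀) r := by
    intro y hy s hs
    rw [← ball_prod_same]; exact ⟨hy, hs⟩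
  have hs₀ : s₀ ∈ Metric.ball s₀ r := Metric.mem_ball_self hr
  have hzmem : ∀ z ∈ Metric.ball (y₀, s₀) r, z.1 ∈ Metric.ball y₀ r ∧ z.2 ∈ Metric.ball s₀ r := by
    intro z hz
    rw [← ball_prod_same] at hz; exact hz
  have hune : ∀ y ∈ Metric.ball y₀ r, y.2.1 ≠ 0 := fun y hy => (hball (hmem y hy s₀ hs₀)).2
  obtain ⟨Q, hQ⟩ : ∃ Q : (Vec3 × Vec3 × ℝ) × (Fin 5 → ℝ) → Vec3,
    Q = fun z => X.charac (ffChart z) := ⟨_, rfl⟩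
  obtain ⟨R, hR⟩ : ∃ R : (Vec3 × Vec3 × ℝ) × (Fin 5 → ℝ) → ℝ,
    R = fun z => P (ffChart z) := ⟨_, rfl⟩
  have hQs : ∀ z ∈ Metric.ball (y₀, s₀) r, ContDiffAt ℝ ∞ Q z := fun z hz => by
    rw [hQ]
    exact (hX.contDiffAt_charac hU (hball hz).1).comp z contDiff_ffChart.contDiffAt
  have hRs : ∀ z ∈ Metric.ball (y₀, s₀) r, ContDiffAt ℝ ∞ R z := fun z hz => by
    rw [hR]
    exact (hP.contDiffAt (hU.mem_nhds (hball hz).1)).comp z contDiff_ffChart.contDiffAt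
  have hdet : ∀ z ∈ Metric.ball (y₀, s₀) r, ∀ μ : Vec3, ∑ i, μ i * z.1.2.1 i = 0 → ∀ t,
      crossL (curlL fun k i => fderiv ℝ Q z (ffDir z μ t i) k) z.1.2.1 +
        z.1.2.2 • crossL z.1.2.1 (Q z) = (fun i => fderiv ℝ R z (ffDir z μ t i)) ∧
      divL (fun k i => fderiv ℝ Q z (ffDir z μ t i) k) = 0 := by
    intro z hz μ hμ t
    rw [hQ, hR]
    exact h.forceFree_chart hU hP hX (hball hz).1 hμ t
  have hμ0 : ∀ u : Vec3, ∑ i, (0 : Vec3) i * u i = 0 := fun u => by simp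
  obtain ⟨p, hp, hRp, hp0⟩ := pressure_depends_on_factor hr hRs hune fun z hz t => by
    have h1 := (hdet z hz 0 (hμ0 _) t).1
    have h2 : ∀ i, fderiv ℝ R z (ffDir z 0 t i) = _ := fun i => (congrFun h1 i).symm
    simp only [h2]
    simp [crossL_eq, Fin.sum_univ_three]
    ring
  have hRd : ∀ z ∈ Metric.ball (y₀, s₀) r, ∀ d, fderiv ℝ R z d = fderiv ℝ p z.1 d.1 := by
    intro z hz d
    have he : R =ᶠ[nhds z] fun z => p z.1 := by
      filter_upwards [Metric.isOpen_ball.mem_nhds hz] with z' hz'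
      exact hRp z' hz'
    have h1 : HasFDerivAt (fun z : (Vec3 × Vec3 × ℝ) × (Fin 5 → ℝ) => z.1)
      (ContinuousLinearMap.fst ℝ _ _) z := hasFDerivAt_fst
    rw [he.fderiv_eq]
    exact congrArg (fun L => L d)
      (((hp z.1 (hzmem z hz).1).differentiableAt (by simp)).hasFDerivAt.comp z h1).fderiv
  have hRdir : ∀ z ∈ Metric.ball (y₀, s₀) r, ∀ μ t,
      (fun i => fderiv ℝ R z (ffDir z μ t i)) = fderiv ℝ p z.1 (0, 0, 1) • μ := by
    intro z hz μ t
    ext i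
    rw [hRd z hz]
    have h1 : (ffDir z μ t i).1 = (Pi.single i 1, (fun k => (ffChart z).2.2 k i : Vec3), 0) +
        μ i • (0, 0, 1) := by
      ext1
      · simp [ffDir]
      · ext1 <;> simp [ffDir]
    rw [h1, map_add, hp0 _ (hzmem z hz).1, map_smul, zero_add, Pi.smul_apply, smul_eq_mul,
      smul_eq_mul, mul_comm]
  have hsplit : ∀ z t, (fun k i => fderiv ℝ Q z (ffDir z 0 t i) k : Grad3) =
      (fun k i => fderiv ℝ Q z (ffDir z 0 0 i) k) +
      fun k i => fderiv ℝ Q z (0, stfCoord fun a b => harm t a b i) k := by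
    intro z t
    ext k i
    rw [ffDir_eq_add, map_add]
    rfl
  obtain ⟨v, w, hv, hw, hvw⟩ := exists_eq_mv_stf_add hQs fun z hz => by
    -- The equation controls the curl only modulo u, so it is tested against a vector orthogonal to
    -- u.
    obtain ⟨n, hn, hnu⟩ := exists_orthogonal z.1.2.1
    have h0 := hdet z hz 0 (hμ0 _) 0
    refine ⟨n, hn, fun t => ?_, fun t => ?_⟩
    · have h1 := (hdet z hz 0 (hμ0 _) t).2
      rw [hsplit, map_add, h0.2, zero_add] at h1
      exact h1
    · have h1 := (hdet z hz 0 (hμ0 _) t).1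
      rw [hsplit, map_add, map_add, add_apply, hRdir z hz 0 t, ← hRdir z hz 0 0, ← h0.1,
        add_right_comm, add_eq_left] at h1
      have h2 := eq_smul_of_cross_eq_zero (hune _ (hzmem z hz).1) h1
      rw [← curlL_apply, h2]
      simp only [Pi.smul_apply, smul_eq_mul, mul_left_comm (n _), ← Finset.mul_sum, hnu, mul_zero]
  -- Subtracting (λ/2) u × v from w replaces `stf s` by the full matrix u₁ in Q = u₁ v + w.
  have hw' : ∀ y ∈ Metric.ball y₀ r,
      ContDiffAt ℝ ∞ (fun y => w y - (y.2.2 / 2) • mv (rot y.2.1) (v y)) y := by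
    intro y hy
    have h1 : ContDiffAt ℝ ∞ (fun y : Vec3 × Vec3 × ℝ => mv (rot y.2.1)) y :=
      (mv.comp rot).contDiff.contDiffAt.comp y contDiff_snd.fst.contDiffAt
    have h2 : ContDiffAt ℝ ∞ (fun y : Vec3 × Vec3 × ℝ => y.2.2 / 2) y :=
      (contDiff_snd.snd.div_const 2).contDiffAt
    exact (hw y hy).sub (h2.smul (h1.clm_apply (hv y hy)))
  refine ⟨r, hr, v, fun y => w y - (y.2.2 / 2) • mv (rot y.2.1) (v y), p, hune, hv, hw', hp,
    fun z hz => by rw [← hRp z hz, hR], hp0, fun y hy s hs μ hμ => ?_⟩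
  have hys := hmem y hy s hs
  have hQe : Q =ᶠ[nhds (y, s)] fun z => mv (ffChart z).2.2 (v z.1) +
      (fun y => w y - (y.2.2 / 2) • mv (rot y.2.1) (v y)) z.1 := by
    filter_upwards [Metric.isOpen_ball.mem_nhds hys] with z hz
    have := hvw z.1 (hzmem z hz).1 z.2 (hzmem z hz).2
    rw [Prod.mk.eta] at this
    rw [this, ffChart]
    simp
  have hd := fderiv_mv_ffChart_add (z := (y, s)) (v := v)
    (w := fun y => w y - (y.2.2 / 2) • mv (rot y.2.1) (v y)) hQe ((hv y hy).differentiableAt (by simp))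
    ((hw' y hy).differentiableAt (by simp))
  have hG : (fun k i => fderiv ℝ Q (y, s) (ffDir (y, s) μ 0 i) k : Grad3) =
      (fun k i => ∑ m, (ffJet (y, s) μ 0).h k m i * v y m) +
      reducedGrad v (fun y => w y - (y.2.2 / 2) • mv (rot y.2.1) (v y)) (y, s) μ := by
    ext k i
    rw [hd, ffMatDeriv_ffDir (y, s) hμ, add_assoc, Pi.add_apply, mv_apply]
    simp [reducedGrad, ffDir, Fin.sum_univ_three]
  have hdet1 := hdet (y, s) hys μ hμ 0
  rw [hG, map_add, map_add, map_add divL, hRdir _ hys, curlL_contract, divL_contract, hQe.eq_of_nhds] at hdet1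
  simp only [divL_ffJet, smul_zero, Finset.sum_const_zero, zero_add] at hdet1
  refine ⟨?_, hdet1.2⟩
  rw [← hdet1.1]
  -- The second derivatives contracted with v have curl λu₁v + (v·μ)u; crossed with u, this cancels
  -- the term λ u × (u₁v) of the equation.
  have hc : ∑ m, v y m • curlL (fun k l => (ffJet (y, s) μ 0).h k l m) =
      y.2.2 • mv (ffChart (y, s)).2.2 (v y) + (∑ m, v y m * μ m) • y.2.1 := by
    simp only [curlL_ffJet (y, s) hμ]
    ext k
    simp [mv_apply, Fin.sum_univ_three]
    ring
  rw [hc]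
  have hself : ∀ a : Vec3, crossL a a = 0 := fun a => by rw [crossL_apply, cross_self]
  have hanti : ∀ a b : Vec3, crossL a b = -crossL b a := fun a b => by
    rw [crossL_apply, crossL_apply, ← cross_anticomm]
  simp only [map_add, map_smul, add_apply, smul_apply, hself, smul_zero, add_zero, smul_add]
  rw [hanti (mv (ffChart (y, s)).2.2 (v y))]
  module

/-! ### Dependence on the factor and the divergence condition -/

theorem mem_ball_triple {x₀ u₀ x u : Vec3} {l₀ l r : ℝ} :
    (x, u, l) ∈ Metric.ball (x₀, u₀, l₀) r ↔ dist x x₀ < r ∧ dist u u₀ < r ∧ dist l l₀ < r := by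
  simp [Metric.mem_ball, Prod.dist_eq]

/-- The first condition makes g parallel to u; the second fixes the multiple because (μ × u) × u =
-|u|²μ for μ orthogonal to u. It is applied with g = u₁ ∂v/∂λ + ∂w/∂λ and c = p'(λ). -/
theorem crossL_eq_zero_or {u g : Vec3} (hu : u ≠ 0) (c : ℝ)
    (h : ∀ μ : Vec3, ∑ i, μ i * u i = 0 → ∑ i, μ i * g i = 0)
    (h' : ∀ μ : Vec3, ∑ i, μ i * u i = 0 → crossL (crossL μ g) u = c • μ) :
    (u 0 ^ 2 + u 1 ^ 2 + u 2 ^ 2) • g = -c • u := by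
  have hu' := sq_pos_of_ne_zero hu
  obtain ⟨q, hq⟩ : ∃ q, q = u 0 ^ 2 + u 1 ^ 2 + u 2 ^ 2 := ⟨_, rfl⟩
  obtain ⟨τ, hτ⟩ : ∃ τ, τ = u 0 * g 0 + u 1 * g 1 + u 2 * g 2 := ⟨_, rfl⟩
  have hm : q • g - τ • u = 0 := by
    have h1 := h (q • g - τ • u) (by simp [Fin.sum_univ_three, hq, hτ]; ring)
    apply vec_eq_zero_of_sq
    simp [Fin.sum_univ_three] at h1 ⊢
    rw [hq, hτ] at *
    linear_combination (u 0 ^ 2 + u 1 ^ 2 + u 2 ^ 2) * h1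
  have hg : q • g = τ • u := sub_eq_zero.1 hm
  obtain ⟨n, hn, hnu⟩ := exists_orthogonal u
  have h2 := h' n hnu
  have h3 : (c + τ) • n = 0 := by
    have h4 : crossL (crossL n g) u = -τ • n := by
      have hq0 : q ≠ 0 := hq ▸ hu'.ne'
      have h5 : g = (τ / q) • u := by
        rw [div_eq_inv_mul, mul_smul, ← hg, smul_smul, inv_mul_cancel₀ hq0, one_smul]
      rw [Fin.sum_univ_three] at hnu
      have h6 : crossL (crossL n u) u = -q • n := by
        rw [hq]
        ext k
        fin_cases k <;> simp [crossL_eq]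
        · linear_combination u 0 * hnu
        · linear_combination u 1 * hnu
        · linear_combination u 2 * hnu
      rw [h5, map_smul, map_smul, smul_apply, h6, smul_smul]
      congr 1
      field_simp
    rw [add_smul, ← h2, h4]
    module
  have h4 : τ = -c := by linarith [(smul_eq_zero.1 h3).resolve_right hn]
  rw [← hq, hg, h4]

theorem reducedGrad_eq_add (v w : Vec3 × Vec3 × ℝ → Vec3)
    (z : (Vec3 × Vec3 × ℝ) × (Fin 5 → ℝ)) (μ : Vec3) :
    reducedGrad v w z μ = reducedGrad v w z 0 + fun k i => μ i *
      (mv (ffChart z).2.2 (fderiv ℝ v z.1 (0, 0, 1)) + fderiv ℝ w z.1 (0, 0, 1)) k := by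
  have h : ∀ i, ((Pi.single i 1, fun k => (ffChart z).2.2 k i, μ i) : Vec3 × Vec3 × ℝ) =
      (Pi.single i 1, fun k => (ffChart z).2.2 k i, 0) + μ i • (0, 0, 1) := by
    intro i; simp
  ext k i
  simp only [reducedGrad, h, map_add, map_smul, Pi.add_apply, Pi.smul_apply, smul_eq_mul,
    Pi.zero_apply]
  ring

/-- The μ-dependent part of the reduced gradient is g ⊗ μ with g = u₁ ∂v/∂λ + ∂w/∂λ. The value that
`crossL_eq_zero_or` gives for g does not depend on s, while u₁ does; hence ∂v/∂λ = 0. -/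
theorem factor_derivative {v w : Vec3 × Vec3 × ℝ → Vec3} {y : Vec3 × Vec3 × ℝ} {c : ℝ}
    {s₀ : Fin 5 → ℝ} {r : ℝ} (hr : 0 < r) (hu : y.2.1 ≠ 0)
    (h : ∀ s ∈ Metric.ball s₀ r, ∀ μ : Vec3, ∑ i, μ i * y.2.1 i = 0 →
      crossL (curlL (reducedGrad v w (y, s) μ)) y.2.1 + y.2.2 • crossL y.2.1 (w y) = c • μ ∧
      divL (reducedGrad v w (y, s) μ) = 0) :
    fderiv ℝ v y (0, 0, 1) = 0 ∧
      (y.2.1 0 ^ 2 + y.2.1 1 ^ 2 + y.2.1 2 ^ 2) • fderiv ℝ w y (0, 0, 1) = -c • y.2.1 := by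
  have key : ∀ s ∈ Metric.ball s₀ r, (y.2.1 0 ^ 2 + y.2.1 1 ^ 2 + y.2.1 2 ^ 2) •
      (mv (ffChart (y, s)).2.2 (fderiv ℝ v y (0, 0, 1)) + fderiv ℝ w y (0, 0, 1)) =
      -c • y.2.1 := by
    intro s hs
    have h0 := h s hs 0 (by simp)
    refine crossL_eq_zero_or hu c (fun μ hμ => ?_) fun μ hμ => ?_
    · have h1 := (h s hs μ hμ).2
      rw [reducedGrad_eq_add, map_add, h0.2, zero_add, divL_eq] at h1
      rw [Fin.sum_univ_three]; exact h1
    · have h1 := (h s hs μ hμ).1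
      rw [smul_zero] at h0
      rw [reducedGrad_eq_add, map_add, map_add, add_apply, add_right_comm, h0.1, zero_add] at h1
      rw [← h1]
      rfl
  have hs₀ : s₀ ∈ Metric.ball s₀ r := Metric.mem_ball_self hr
  have hq := (sq_pos_of_ne_zero hu).ne'
  have hv : fderiv ℝ v y (0, 0, 1) = 0 := by
    have h1 : ∀ d, mv (stf d) (fderiv ℝ v y (0, 0, 1)) = 0 := by
      intro d
      obtain ⟨ε, hε, hm⟩ := exists_smul_add_mem_ball hr (s₀ := s₀) d
      have h2 := (key _ hm).trans (key _ hs₀).symm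
      have h3 := (smul_right_injective _ hq) h2
      simp only [ffChart, map_add, map_smul, add_apply, smul_apply] at h3
      have h4 : ε • mv (stf d) (fderiv ℝ v y (0, 0, 1)) = 0 := by
        linear_combination (exp := 1) h3
      exact (smul_eq_zero.1 h4).resolve_left hε.ne'
    have e1 := h1 ![1, 0, 0, 0, 0]
    have e2 := h1 ![0, 1, 0, 0, 0]
    simp only [funext_iff, mv_apply, stf_eq, Fin.forall_fin_succ] at e1 e2
    simp at e1 e2
    ext k
    fin_cases k <;> simp [e1, e2]
  refine ⟨hv, ?_⟩
  have := key s₀ hs₀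
  rwa [hv, map_zero, zero_add] at this

theorem reducedGrad_zero_eq (v w : Vec3 × Vec3 × ℝ → Vec3)
    (z : (Vec3 × Vec3 × ℝ) × (Fin 5 → ℝ)) :
    reducedGrad v w z 0 = quadGrad (fun k i => fderiv ℝ v z.1 (Pi.single i 1, 0, 0) k)
      (fun k m => fderiv ℝ v z.1 (0, Pi.single m 1, 0) k)
      (fun k i => fderiv ℝ w z.1 (Pi.single i 1, 0, 0) k)
      (fun k m => fderiv ℝ w z.1 (0, Pi.single m 1, 0) k) (ffChart z).2.2 := by
  ext k i
  have h : ((Pi.single i 1, fun k => (ffChart z).2.2 k i, (0 : Vec3) i) : Vec3 × Vec3 × ℝ) =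
      (Pi.single i 1, 0, 0) + ∑ m, (ffChart z).2.2 m i •
        ((0, Pi.single m 1, 0) : Vec3 × Vec3 × ℝ) := by
    ext1
    · simp [Fin.sum_univ_three]
    · ext1
      · conv_lhs => simp only []
        rw [sum_smul_single fun k => (ffChart z).2.2 k i]
        simp [Fin.sum_univ_three]
      · simp [Fin.sum_univ_three]
  have hf : ∀ f : Vec3 × Vec3 × ℝ → Vec3,
      fderiv ℝ f z.1 (Pi.single i 1, fun k => (ffChart z).2.2 k i, (0 : Vec3) i) =
      fderiv ℝ f z.1 (Pi.single i 1, 0, 0) +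
        ∑ m, (ffChart z).2.2 m i • fderiv ℝ f z.1 (0, Pi.single m 1, 0) := by
    intro f
    rw [h, map_add, map_sum]
    simp only [map_smul]
  rw [reducedGrad, hf, hf]
  simp [quadGrad, mm_apply, mv_apply, Fin.sum_univ_three]
  ring

/-- V is antisymmetric, with axial vector b = (V 2 1, V 0 2, V 1 0). The cross terms of tr(pVp)
between `stf c` and (l/2) `rot u` then amount to l b·(`stf c` u), the only explicit occurrence of
the factor. -/
theorem divL_quadGrad {X V Z W : Grad3} {s₀ : Fin 5 → ℝ} {r l : ℝ} {u : Vec3} (hr : 0 < r)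
    (h : ∀ s ∈ Metric.ball s₀ r, divL (quadGrad X V Z W (stf s + (l / 2) • rot u)) = 0) :
    (∀ k m, V m k = -V k m) ∧
      ∀ c, divL (mm (stf c) X) + divL (mm W (stf c)) +
        l * ∑ k, ![V 2 1, V 0 2, V 1 0] k * mv (stf c) u k = 0 := by
  have h1 := quadGrad_coeff divL hr h
  obtain ⟨v00, v11, v22, v10, v20, v21⟩ := antisymm_of_divL_eq_zero fun c => (h1 c).2
  refine ⟨fun k m => ?_, fun c => ?_⟩
  · fin_cases k <;> fin_cases m <;> simp [v00, v11, v22, v10, v20, v21]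
  · rw [← (h1 c).1]
    simp [divL_eq, mm_apply, mv_apply, stf_eq, rot_eq, Fin.sum_univ_three, v00, v11, v22, v10, v20,
      v21]
    ring

/-! ### Inversion in the field and constancy of the pressure for u ≠ 0 -/

/-- The scalar product as a continuous bilinear map. -/
noncomputable def dotL : Vec3 →L[ℝ] Vec3 →L[ℝ] ℝ :=
  LinearMap.toContinuousBilinearMap (LinearMap.mk₂ ℝ (fun u v : Vec3 => ∑ i, u i * v i)
    (fun u v w => by simp [add_mul, Finset.sum_add_distrib])
    (fun c v w => by simp [Finset.mul_sum, mul_assoc])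
    (fun u v w => by simp [mul_add, Finset.sum_add_distrib])
    (fun c v w => by simp [Finset.mul_sum, mul_left_comm]))

theorem dotL_apply (u v : Vec3) : dotL u v = u 0 * v 0 + u 1 * v 1 + u 2 * v 2 := by
  have : dotL u v = ∑ i, u i * v i := rfl
  rw [this, Fin.sum_univ_three]

theorem dotL_self_ne_zero {u : Vec3} (hu : u ≠ 0) : dotL u u ≠ 0 := by
  rw [dotL_apply]
  have := sq_pos_of_ne_zero hu
  intro h
  linarith

theorem contDiffAt_inversion {u : Vec3} (hu : u ≠ 0) :
    ContDiffAt ℝ ∞ (fun u : Vec3 => (dotL u u)⁻¹ • u) u := by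
  have h : ContDiffAt ℝ ∞ (fun u : Vec3 => dotL u u) u :=
    (dotL.contDiff.clm_apply contDiff_id).contDiffAt
  exact (h.inv (dotL_self_ne_zero hu)).smul contDiffAt_id

theorem fderiv_inversion {u : Vec3} (hu : u ≠ 0) (a : Vec3) :
    fderiv ℝ (fun u : Vec3 => (dotL u u)⁻¹ • u) u a =
      (dotL u u)⁻¹ • a - (2 * dotL u a / dotL u u ^ 2) • u := by
  have h1 : HasFDerivAt (fun u : Vec3 => dotL u u) _ u :=
    (dotL.hasFDerivAt (x := u)).clm_apply (hasFDerivAt_id u)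
  have h2 := ((HasDerivAt.comp_hasFDerivAt (h₂ := fun x : ℝ => x⁻¹) (f := fun u : Vec3 => dotL u u) u
    (hasDerivAt_inv (dotL_self_ne_zero hu)) h1).smul (hasFDerivAt_id u)).fderiv
  refine (congrArg (fun L => L a) h2).trans ?_
  have hs : dotL a u = dotL u a := by rw [dotL_apply, dotL_apply]; ring
  simp [hs]
  rw [sub_eq_add_neg, ← neg_smul]
  congr 2
  field_simp
  ring

/-- Since second derivatives commute, a direction annihilated by the derivative of f is annihilated
by the derivative of each of its directional derivatives. -/
theorem fderiv_apply_eq_of_ker {F : Type*} [NormedAddCommGroup F] [NormedSpace ℝ F]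
    {E : Type*} [NormedAddCommGroup E] [NormedSpace ℝ E] {f : E → F} {B : Set E}
    (hB : IsOpen B) (hc : Convex ℝ B) (hf : ∀ y ∈ B, ContDiffAt ℝ ∞ f y) {y y' : E} (hy : y ∈ B)
    (hy' : y' ∈ B) (h : ∀ z ∈ B, fderiv ℝ f z (y' - y) = 0) (a : E) :
    fderiv ℝ f y a = fderiv ℝ f y' a := by
  refine eq_of_fderiv_apply_sub_eq_zero (f := fun y => fderiv ℝ f y a) hc
    (fun z hz => (contDiffAt_fderiv_apply (hf z hz) a).differentiableAt (by simp)) hy hy' ?_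
  intro z hz
  rw [fderiv_fderiv_apply_comm (hf z hz)]
  have he : (fun z => fderiv ℝ f z (y' - y)) =ᶠ[nhds z] fun _ => 0 := by
    filter_upwards [hB.mem_nhds hz] with z' hz'
    exact h z' hz'
  rw [he.fderiv_eq]
  simp

theorem divergence_condition {v w : Vec3 × Vec3 × ℝ → Vec3} {y : Vec3 × Vec3 × ℝ}
    {s₀ : Fin 5 → ℝ} {r : ℝ} (hr : 0 < r)
    (h : ∀ s ∈ Metric.ball s₀ r, divL (reducedGrad v w (y, s) 0) = 0) :
    (∀ m k : Fin 3, fderiv ℝ v y (0, Pi.single m 1, 0) k =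
      -fderiv ℝ v y (0, Pi.single k 1, 0) m) ∧
    ∀ c, divL (mm (stf c) fun k i => fderiv ℝ v y (Pi.single i 1, 0, 0) k) +
      divL (mm (fun k m => fderiv ℝ w y (0, Pi.single m 1, 0) k) (stf c)) +
      y.2.2 * ∑ k, ![fderiv ℝ v y (0, Pi.single 1 1, 0) 2, fderiv ℝ v y (0, Pi.single 2 1, 0) 0,
        fderiv ℝ v y (0, Pi.single 0 1, 0) 1] k * mv (stf c) y.2.1 k = 0 := by
  have h1 := divL_quadGrad (X := fun k i => fderiv ℝ v y (Pi.single i 1, 0, 0) k)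
    (V := fun k m => fderiv ℝ v y (0, Pi.single m 1, 0) k)
    (Z := fun k i => fderiv ℝ w y (Pi.single i 1, 0, 0) k)
    (W := fun k m => fderiv ℝ w y (0, Pi.single m 1, 0) k) (l := y.2.2) (u := y.2.1) hr
    fun s hs => (congrArg divL (reducedGrad_zero_eq v w (y, s)).symm).trans (h s hs)
  exact ⟨fun m k => h1.1 m k, h1.2⟩

/-- A vector field with antisymmetric derivative is affine. -/
theorem fderiv_fderiv_eq_zero_of_antisymm {v : Vec3 × Vec3 × ℝ → Vec3}
    {B : Set (Vec3 × Vec3 × ℝ)} (hB : IsOpen B) (hv : ∀ y ∈ B, ContDiffAt ℝ ∞ v y)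
    (h : ∀ y ∈ B, ∀ m k : Fin 3, fderiv ℝ v y (0, Pi.single m 1, 0) k =
      -fderiv ℝ v y (0, Pi.single k 1, 0) m) {y : Vec3 × Vec3 × ℝ} (hy : y ∈ B) (m n k : Fin 3) :
    fderiv ℝ (fun y => fderiv ℝ v y (0, Pi.single m 1, 0)) y (0, Pi.single n 1, 0) k = 0 := by
  have hvs := fun m : Fin 3 => contDiffAt_fderiv_apply (hv y hy) (0, Pi.single m 1, 0)
  obtain ⟨T, hT⟩ : ∃ T : Fin 3 → Fin 3 → Fin 3 → ℝ, ∀ m n k,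
    T m n k = fderiv ℝ (fun y => fderiv ℝ v y (0, Pi.single m 1, 0)) y (0, Pi.single n 1, 0) k :=
    ⟨_, fun m n k => rfl⟩
  have hsym : ∀ m n k, T m n k = T n m k := fun m n k => by
    rw [hT, hT, fderiv_fderiv_apply_comm (hv y hy)]
  have hanti : ∀ m n k, T m n k = -T k n m := by
    intro m n k
    have comp : ∀ m k a, fderiv ℝ (fun y => fderiv ℝ v y (0, Pi.single m 1, 0) k) y a =
        fderiv ℝ (fun y => fderiv ℝ v y (0, Pi.single m 1, 0)) y a k := fun m k a =>
      congrArg (fun L => L a)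
        (hasFDerivAt_pi'.1 ((hvs m).differentiableAt (by simp)).hasFDerivAt k).fderiv
    have he : (fun y => fderiv ℝ v y (0, Pi.single m 1, 0) k) =ᶠ[nhds y]
        fun y => -fderiv ℝ v y (0, Pi.single k 1, 0) m := by
      filter_upwards [hB.mem_nhds hy] with y' hy'
      exact h y' hy' m k
    rw [hT, hT, ← comp, ← comp, he.fderiv_eq, fderiv_fun_neg, neg_apply]
  rw [← hT]
  have h1 := hanti m n k
  have h2 := hsym k n m
  have h3 := hanti n k m
  have h4 := hsym m k n
  have h5 := hanti k m n
  have h6 := hsym n m k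
  linarith

/-- Constancy of the pressure from the reduced determining conditions. -/
theorem pressure_eq_of_reduced {v w : Vec3 × Vec3 × ℝ → Vec3} {p : Vec3 × Vec3 × ℝ → ℝ}
    {x₀ u₀ : Vec3} {l₀ r : ℝ} {s₀ : Fin 5 → ℝ} (hr : 0 < r)
    (hu : ∀ y ∈ Metric.ball (x₀, u₀, l₀) r, y.2.1 ≠ 0)
    (hv : ∀ y ∈ Metric.ball (x₀, u₀, l₀) r, ContDiffAt ℝ ∞ v y)
    (hw : ∀ y ∈ Metric.ball (x₀, u₀, l₀) r, ContDiffAt ℝ ∞ w y)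
    (hp : ∀ y ∈ Metric.ball (x₀, u₀, l₀) r, ContDiffAt ℝ ∞ p y)
    (hp0 : ∀ y ∈ Metric.ball (x₀, u₀, l₀) r, ∀ a b, fderiv ℝ p y (a, b, 0) = 0)
    (h : ∀ y ∈ Metric.ball (x₀, u₀, l₀) r, ∀ s ∈ Metric.ball s₀ r, ∀ μ : Vec3,
      ∑ i, μ i * y.2.1 i = 0 →
      crossL (curlL (reducedGrad v w (y, s) μ)) y.2.1 + y.2.2 • crossL y.2.1 (w y) =
        fderiv ℝ p y (0, 0, 1) • μ ∧ divL (reducedGrad v w (y, s) μ) = 0)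
    {l : ℝ} (hl : dist l l₀ < r) : p (x₀, u₀, l) = p (x₀, u₀, l₀) := by
  have hopen : IsOpen (Metric.ball (x₀, u₀, l₀) r) := Metric.isOpen_ball
  have hconv : Convex ℝ (Metric.ball (x₀, u₀, l₀) r) := convex_ball _ _
  have hfac := fun y hy => factor_derivative hr (hu y hy) (h y hy)
  have hdiv := fun y hy => divergence_condition hr fun s hs => (h y hy s hs 0 (by simp)).2
  obtain ⟨N, hN⟩ : ∃ N : Vec3 → Vec3, N = fun u => (dotL u u)⁻¹ • u := ⟨_, rfl⟩
  -- As ∂w/∂λ = -p'(λ) u/|u|², adding p(λ) u/|u|² removes the dependence on λ.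
  obtain ⟨w₀, hw₀⟩ : ∃ w₀ : Vec3 × Vec3 × ℝ → Vec3, w₀ = fun y => w y + p y • N y.2.1 := ⟨_, rfl⟩
  have hNs : ∀ y ∈ Metric.ball (x₀, u₀, l₀) r, ContDiffAt ℝ ∞ N y.2.1 := fun y hy =>
    hN ▸ contDiffAt_inversion (hu y hy)
  have hws : ∀ y ∈ Metric.ball (x₀, u₀, l₀) r, ContDiffAt ℝ ∞ w₀ y := fun y hy => by
    rw [hw₀]
    exact (hw y hy).add ((hp y hy).smul ((hNs y hy).comp y contDiff_snd.fst.contDiffAt))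
  have hwd : ∀ y ∈ Metric.ball (x₀, u₀, l₀) r, ∀ a, fderiv ℝ w₀ y a =
      fderiv ℝ w y a + p y • fderiv ℝ N y.2.1 a.2.1 + fderiv ℝ p y a • N y.2.1 := by
    intro y hy a
    have h1 : HasFDerivAt (fun y : Vec3 × Vec3 × ℝ => y.2.1) ((ContinuousLinearMap.fst ℝ _ _).comp
      (ContinuousLinearMap.snd ℝ _ _)) y := ((ContinuousLinearMap.fst ℝ Vec3 ℝ).comp
        (ContinuousLinearMap.snd ℝ Vec3 (Vec3 × ℝ))).hasFDerivAt
    have h2 := ((hNs y hy).differentiableAt (by simp)).hasFDerivAt.comp y h1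
    have h3 := (((hw y hy).differentiableAt (by simp)).hasFDerivAt.add
      (((hp y hy).differentiableAt (by simp)).hasFDerivAt.smul h2)).fderiv
    rw [hw₀]
    refine (congrArg (fun L => L a) h3).trans ?_
    simp [add_assoc]
  have hw1 : ∀ y ∈ Metric.ball (x₀, u₀, l₀) r, fderiv ℝ w₀ y (0, 0, 1) = 0 := by
    intro y hy
    have h1 := (hfac y hy).2
    have hq : y.2.1 0 ^ 2 + y.2.1 1 ^ 2 + y.2.1 2 ^ 2 = dotL y.2.1 y.2.1 := by
      rw [dotL_apply]; ring
    rw [hq] at h1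
    have h2 : fderiv ℝ w y (0, 0, 1) = -fderiv ℝ p y (0, 0, 1) • (dotL y.2.1 y.2.1)⁻¹ • y.2.1 := by
      rw [smul_comm, ← h1, smul_smul, inv_mul_cancel₀ (dotL_self_ne_zero (hu y hy)), one_smul]
    rw [hwd y hy, h2, hN]
    simp
  have hvu := fun y hy => fderiv_fderiv_eq_zero_of_antisymm hopen hv (fun y hy => (hdiv y hy).1) (y := y) hy
  have hu₀ : u₀ ≠ 0 := hu _ (Metric.mem_ball_self hr)
  -- The divergence conditions at l and l₀ are subtracted: v and w₀ cancel, leaving the explicit λ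
  -- term and the symmetric traceless part of Δp times the derivative of u/|u|², which comes from -2
  -- u⊗u/|u|⁴. The vector b may be read off at u₀, because v is affine in u.
  have hcmp : ∀ u, dist u u₀ < r → ∃ b : Vec3, (∀ k, b k = ![fderiv ℝ v (x₀, u₀, l₀)
      (0, Pi.single 1 1, 0) 2, fderiv ℝ v (x₀, u₀, l₀) (0, Pi.single 2 1, 0) 0,
      fderiv ℝ v (x₀, u₀, l₀) (0, Pi.single 0 1, 0) 1] k) ∧
      (l - l₀) • b + (2 * (p (x₀, u₀, l) - p (x₀, u₀, l₀)) / dotL u u ^ 2) • u = 0 := by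
    intro u hud
    have hm : (x₀, u, l) ∈ Metric.ball (x₀, u₀, l₀) r :=
      mem_ball_triple.2 ⟨by simpa using hr, hud, hl⟩
    have hm₀ : (x₀, u, l₀) ∈ Metric.ball (x₀, u₀, l₀) r :=
      mem_ball_triple.2 ⟨by simpa using hr, hud, by simpa using hr⟩
    have hc₀ : (x₀, u₀, l₀) ∈ Metric.ball (x₀, u₀, l₀) r := Metric.mem_ball_self hr
    have hc : (x₀, u₀, l) ∈ Metric.ball (x₀, u₀, l₀) r :=
      mem_ball_triple.2 ⟨by simpa using hr, by simpa using hr, hl⟩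
    have hdl : ((x₀, u, l) - (x₀, u, l₀) : Vec3 × Vec3 × ℝ) = (l - l₀) • (0, 0, 1) := by simp
    have hvl : ∀ a, fderiv ℝ v (x₀, u, l₀) a = fderiv ℝ v (x₀, u, l) a :=
      fderiv_apply_eq_of_ker hopen hconv hv hm₀ hm fun z hz => by
        rw [hdl, map_smul, (hfac z hz).1, smul_zero]
    have hwl : ∀ a, fderiv ℝ w₀ (x₀, u, l₀) a = fderiv ℝ w₀ (x₀, u, l) a :=
      fderiv_apply_eq_of_ker hopen hconv hws hm₀ hm fun z hz => by
        rw [hdl, map_smul, hw1 z hz, smul_zero]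
    have hpu : ∀ l', dist l' l₀ < r → p (x₀, u, l') = p (x₀, u₀, l') := by
      intro l' hl'
      refine eq_of_fderiv_apply_sub_eq_zero hconv
        (fun z hz => (hp z hz).differentiableAt (by simp))
        (mem_ball_triple.2 ⟨by simpa using hr, hud, hl'⟩)
        (mem_ball_triple.2 ⟨by simpa using hr, by simpa using hr, hl'⟩) fun z hz => ?_
      have : ((x₀, u₀, l') - (x₀, u, l') : Vec3 × Vec3 × ℝ) = (0, u₀ - u, 0) := by simp
      rw [this, hp0 z hz]
    have hvu' : ∀ m k, fderiv ℝ v (x₀, u₀, l₀) (0, Pi.single m 1, 0) k =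
        fderiv ℝ v (x₀, u, l₀) (0, Pi.single m 1, 0) k := by
      intro m k
      have h1 := eq_of_fderiv_apply_sub_eq_zero
        (f := fun y => fderiv ℝ v y (0, Pi.single m 1, 0)) hconv
        (fun z hz => (contDiffAt_fderiv_apply (hv z hz) _).differentiableAt (by simp)) hc₀ hm₀
        fun z hz => by
          have h2 : ((x₀, u, l₀) - (x₀, u₀, l₀) : Vec3 × Vec3 × ℝ) =
              ∑ n, (u - u₀) n • (0, Pi.single n 1, 0) := by
            ext1
            · simp [Fin.sum_univ_three]
            · ext1
              · conv_lhs => simp only [Prod.snd_sub, Prod.fst_sub]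
                rw [sum_smul_single (u - u₀)]
                simp [Fin.sum_univ_three]
              · simp [Fin.sum_univ_three]
          rw [h2, map_sum]
          refine Finset.sum_eq_zero fun n _ => ?_
          rw [map_smul]
          have : fderiv ℝ (fun y => fderiv ℝ v y (0, Pi.single m 1, 0)) z
              (0, Pi.single n 1, 0) = 0 := funext fun k => hvu z hz m n k
          rw [this, smul_zero]
      exact congrFun h1 k
    refine ⟨_, fun k => rfl, ?_⟩
    have hune : u ≠ 0 := hu _ hm
    refine eq_zero_of_stf_pairing hune fun c => ?_
    have d1 := (hdiv _ hm).2 c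
    have d0 := (hdiv _ hm₀).2 c
    have hW : ∀ l', (x₀, u, l') ∈ Metric.ball (x₀, u₀, l₀) r → ∀ k m,
        fderiv ℝ w (x₀, u, l') (0, Pi.single m 1, 0) k =
        fderiv ℝ w₀ (x₀, u, l') (0, Pi.single m 1, 0) k -
          p (x₀, u, l') * fderiv ℝ N u (Pi.single m 1) k := by
      intro l' hl' k m
      rw [hwd _ hl', hp0 _ hl']
      simp
    have hDN : ∀ k m, fderiv ℝ N u (Pi.single m 1) k =
        (dotL u u)⁻¹ * (Pi.single m 1 : Vec3) k - 2 * u m / dotL u u ^ 2 * u k := by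
      intro k m
      have : dotL u (Pi.single m 1) = u m := by
        fin_cases m <;> simp [dotL_apply]
      rw [hN, fderiv_inversion hune, this]
      simp
    have hq := dotL_self_ne_zero hune
    simp only [hvl, hvu', hW _ hm, hW _ hm₀, hwl, hpu _ hl, hpu l₀ (by simpa using hr)] at d0 d1 ⊢
    simp only [hDN] at d0 d1
    obtain ⟨q, hqq⟩ : ∃ q, q = dotL u u := ⟨_, rfl⟩
    rw [← hqq] at d0 d1 hq ⊢
    simp [divL_eq, mm_apply, mv_apply, stf_eq, Fin.sum_univ_three] at d0 d1 ⊢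
    linear_combination d1 - d0
  -- At (1 + ε)u₀ the b term is unchanged, while u/|u|⁴ is multiplied by (1 + ε)⁻³.
  obtain ⟨ε, hε, hm⟩ := exists_smul_add_mem_ball hr (s₀ := u₀) u₀
  obtain ⟨b, hb, e0⟩ := hcmp u₀ (by simpa using hr)
  obtain ⟨b', hb', e1⟩ := hcmp _ hm
  have hbb : b' = b := funext fun k => (hb' k).trans (hb k).symm
  rw [hbb] at e1
  have hq := dotL_self_ne_zero hu₀
  have hε1 : (1 + ε) ≠ 0 := by positivity
  have hd : dotL (u₀ + ε • u₀) (u₀ + ε • u₀) = (1 + ε) ^ 2 * dotL u₀ u₀ := by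
    rw [dotL_apply, dotL_apply]; simp; ring
  rw [hd] at e1
  have e2 : (2 * (p (x₀, u₀, l) - p (x₀, u₀, l₀)) / dotL u₀ u₀ ^ 2 * (1 - 1 / (1 + ε) ^ 3)) • u₀ =
      0 := by
    have : (2 * (p (x₀, u₀, l) - p (x₀, u₀, l₀)) / ((1 + ε) ^ 2 * dotL u₀ u₀) ^ 2) •
        (u₀ + ε • u₀) = (2 * (p (x₀, u₀, l) - p (x₀, u₀, l₀)) / dotL u₀ u₀ ^ 2 *
        (1 / (1 + ε) ^ 3)) • u₀ := by
      have h1 : u₀ + ε • u₀ = (1 + ε) • u₀ := by rw [add_smul, one_smul]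
      rw [h1, smul_smul]
      congr 1
      field_simp
    rw [this] at e1
    rw [mul_sub, sub_smul, mul_one]
    linear_combination (exp := 1) e0 - e1
  have e3 := (smul_eq_zero.1 e2).resolve_right hu₀
  have h3 : (1 : ℝ) - 1 / (1 + ε) ^ 3 ≠ 0 := by
    have h4 : 1 < (1 + ε) ^ 3 := one_lt_pow₀ (by linarith) (by norm_num)
    have h5 : 1 / (1 + ε) ^ 3 < 1 := by rw [div_lt_one (by positivity)]; exact h4
    linarith
  have e4 := (mul_eq_zero.1 e3).resolve_right h3
  rw [div_eq_zero_iff] at e4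
  have e5 := e4.resolve_right (pow_ne_zero 2 hq)
  linarith

/-! ### Local constancy on the whole force-free variety -/

theorem forceFreeSys_eq_zero_iff {j : Jet1} : forceFreeSys j = 0 ↔
    crossL (curlL j.2.2) j.2.1 = 0 ∧ divL j.2.2 = 0 := by
  rw [forceFreeSys, Prod.mk_eq_zero]; rfl

/-- The coordinates of `ffChart`. -/
noncomputable def ffCoord (j : Jet1) : (Vec3 × Vec3 × ℝ) × (Fin 5 → ℝ) :=
  ((j.1, j.2.1, dotL (curlL j.2.2) j.2.1 / dotL j.2.1 j.2.1), stfCoord j.2.2)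

theorem continuous_stfCoord : Continuous stfCoord := by
  refine continuous_pi fun a => ?_
  fin_cases a <;> simp only [stfCoord] <;> simp <;> fun_prop

theorem continuousAt_ffCoord {j : Jet1} (hj : j.2.1 ≠ 0) : ContinuousAt ffCoord j := by
  have h1 : Continuous fun j : Jet1 => dotL (curlL j.2.2) j.2.1 := by fun_prop
  have h2 : Continuous fun j : Jet1 => dotL j.2.1 j.2.1 := by fun_prop
  have h3 : Continuous fun j : Jet1 => stfCoord j.2.2 :=
    continuous_stfCoord.comp continuous_snd.snd
  exact (continuous_fst.continuousAt.prodMk (continuous_snd.fst.continuousAt.prodMk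
    (h1.continuousAt.div h2.continuousAt (dotL_self_ne_zero hj)))).prodMk h3.continuousAt

theorem ffChart_ffCoord {j : Jet1} (hj : j.2.1 ≠ 0) (h : forceFreeSys j = 0) :
    ffChart (ffCoord j) = j := by
  obtain ⟨h1, h2⟩ := forceFreeSys_eq_zero_iff.1 h
  have h3 := eq_smul_of_cross_eq_zero hj h1
  have h4 : curlL j.2.2 = (dotL (curlL j.2.2) j.2.1 / dotL j.2.1 j.2.1) • j.2.1 := by
    conv_lhs => rw [h3]
    congr 1
    rw [dotL_apply, dotL_apply]
    congr 1 <;> ring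
  have h5 := eq_stf_add_rot h2
  rw [← curlL_apply, h4, map_smul, smul_smul] at h5
  refine Prod.ext rfl (Prod.ext rfl ?_)
  conv_rhs => rw [h5]
  simp only [ffChart, ffCoord]
  congr 2
  ring

section Pressure

variable {U : Set Jet1} {P : Jet1 → ℝ} {X : InfOp}

theorem pressure_eventually_eq_of_ne_zero (hU : IsOpen U) (hP : ContDiffOn ℝ ∞ P U)
    (hX : X.SmoothOn U) (h : ModifiedDetermining U forceFreeSys (plasmaRhs P) X)
    {j : Jet1} (hj : j ∈ U) (hs : forceFreeSys j = 0) (hu : j.2.1 ≠ 0) :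
    ∀ᶠ j' in nhds j, forceFreeSys j' = 0 → P j' = P j := by
  have hz : ffChart (ffCoord j) = j := ffChart_ffCoord hu hs
  obtain ⟨r, hr, v, w, p, hune, hv, hw, hp, hPp, hp0, hdet⟩ :=
    exists_reduction (y₀ := (ffCoord j).1) (s₀ := (ffCoord j).2) hU hP hX h (by rw [hz]; exact hj) hu
  have hnear : ∀ᶠ j' in nhds j, ffCoord j' ∈ Metric.ball (ffCoord j) r :=
    (continuousAt_ffCoord hu).eventually (Metric.ball_mem_nhds _ hr)
  have hne : ∀ᶠ j' : Jet1 in nhds j, j'.2.1 ≠ 0 :=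
    (continuous_snd.fst.continuousAt (x := j)).eventually_ne hu
  have hp1 : ∀ y ∈ Metric.ball (ffCoord j).1 r, p y = p (ffCoord j).1 := by
    rintro ⟨x, u, l⟩ hy
    have hy' := mem_ball_triple.1 hy
    have h1 : p (x, u, l) = p ((ffCoord j).1.1, (ffCoord j).1.2.1, l) := by
      refine eq_of_fderiv_apply_sub_eq_zero (convex_ball _ _)
        (fun z hz => (hp z hz).differentiableAt (by simp)) hy
        (mem_ball_triple.2 ⟨(dist_self _).trans_lt hr, (dist_self _).trans_lt hr, hy'.2.2⟩) fun z hz => ?_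
      have : (((ffCoord j).1.1, (ffCoord j).1.2.1, l) - (x, u, l) : Vec3 × Vec3 × ℝ) =
        ((ffCoord j).1.1 - x, (ffCoord j).1.2.1 - u, 0) := by simp
      rw [this, hp0 z hz]
    rw [h1]
    exact pressure_eq_of_reduced hr hune hv hw hp hp0 hdet hy'.2.2
  filter_upwards [hnear, hne] with j' hj' hne' hs'
  have h1 := hPp _ hj'
  have h2 := hPp _ (Metric.mem_ball_self hr)
  rw [Prod.mk.eta, hz] at h2
  rw [ffChart_ffCoord hne' hs'] at h1
  have h3 : (ffCoord j').1 ∈ Metric.ball (ffCoord j).1 r := by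
    have := hj'
    rw [← Prod.mk.eta (p := ffCoord j), ← ball_prod_same] at this
    exact this.1
  rw [h1, h2, hp1 _ h3]

/-- Turns local constancy at regular points into a closed condition on dP, which can be carried to u
= 0 by continuity. -/
theorem fderiv_pressure_tangent (hU : IsOpen U) (hP : ContDiffOn ℝ ∞ P U)
    (hX : X.SmoothOn U) (h : ModifiedDetermining U forceFreeSys (plasmaRhs P) X)
    {γ : ℝ → Jet1} {d : Jet1} (hγ : HasDerivAt γ d 0) (hj : γ 0 ∈ U)
    (hs : ∀ t, forceFreeSys (γ t) = 0) (hu : (γ 0).2.1 ≠ 0) : fderiv ℝ P (γ 0) d = 0 := by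
  have h1 : DifferentiableAt ℝ P (γ 0) :=
    (hP.contDiffAt (hU.mem_nhds hj)).differentiableAt (by simp)
  have h2 := h1.hasFDerivAt.comp_hasDerivAt 0 hγ
  have h3 : P ∘ γ =ᶠ[nhds 0] fun _ => P (γ 0) := by
    filter_upwards [hγ.continuousAt.eventually
      (pressure_eventually_eq_of_ne_zero hU hP hX h hj (hs 0) hu)] with t ht
    exact ht (hs t)
  exact (h2.congr_of_eventuallyEq h3.symm).unique (hasDerivAt_const 0 _)

theorem eq_zero_of_punctured {f : ℝ → ℝ} (hf : ContinuousAt f 0)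
    (h : ∀ᶠ t in nhds (0 : ℝ), t ≠ 0 → f t = 0) : f 0 = 0 := by
  have h1 : Filter.Tendsto f (nhdsWithin 0 {0}ᶜ) (nhds (f 0)) := hf.tendsto.mono_left nhdsWithin_le_nhds
  have h2 : f =ᶠ[nhdsWithin 0 {0}ᶜ] fun _ => 0 := by
    filter_upwards [nhdsWithin_le_nhds h, self_mem_nhdsWithin] with t ht ht0
    exact ht ht0
  exact tendsto_nhds_unique (h1.congr' h2) tendsto_const_nhds

theorem continuousAt_fderiv_curve (hU : IsOpen U) (hP : ContDiffOn ℝ ∞ P U) {γ d : ℝ → Jet1}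
    (hγ : Continuous γ) (hd : Continuous d) (hj : γ 0 ∈ U) :
    ContinuousAt (fun t => fderiv ℝ P (γ t) (d t)) 0 := by
  have h1 : ContinuousAt (fderiv ℝ P) (γ 0) :=
    ((hP.contDiffAt (hU.mem_nhds hj)).fderiv_right (m := ∞) (by simp)).continuousAt
  exact (h1.comp hγ.continuousAt).clm_apply hd.continuousAt

/-- The force-free equations are preserved when u is scaled with u₁ fixed; t = 0 is the limit of
regular points. -/
theorem fderiv_pressure_field (hU : IsOpen U) (hP : ContDiffOn ℝ ∞ P U)
    (hX : X.SmoothOn U) (h : ModifiedDetermining U forceFreeSys (plasmaRhs P) X)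
    {j : Jet1} (hs : forceFreeSys j = 0) (t : ℝ) (hj : ((j.1, t • j.2.1, j.2.2) : Jet1) ∈ U) :
    fderiv ℝ P (j.1, t • j.2.1, j.2.2) (0, j.2.1, 0) = 0 := by
  by_cases hu : j.2.1 = 0
  · rw [hu]; exact map_zero _
  have hS : ∀ t : ℝ, forceFreeSys (j.1, t • j.2.1, j.2.2) = 0 := fun t => by
    rw [forceFreeSys_eq_zero_iff] at hs ⊢
    simp [hs.1, hs.2]
  have hne : ∀ t : ℝ, t ≠ 0 → ((j.1, t • j.2.1, j.2.2) : Jet1) ∈ U →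
      fderiv ℝ P (j.1, t • j.2.1, j.2.2) (0, j.2.1, 0) = 0 := by
    intro t ht hjt
    have h1 : HasDerivAt (fun τ : ℝ => ((j.1, (t + τ) • j.2.1, j.2.2) : Jet1)) (0, j.2.1, 0) 0 := by
      have h2 : HasDerivAt (fun τ : ℝ => (t + τ) • j.2.1) ((1 : ℝ) • j.2.1) 0 :=
        ((hasDerivAt_id (0 : ℝ)).const_add t).smul_const j.2.1
      rw [one_smul] at h2
      exact (hasDerivAt_const 0 j.1).prodMk (h2.prodMk (hasDerivAt_const 0 j.2.2))
    have h3 := fderiv_pressure_tangent hU hP hX h h1 (by simpa using hjt) (fun τ => hS _)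
      (by simpa using ⟨ht, hu⟩)
    simpa using h3
  by_cases ht : t = 0
  · subst ht
    have hc : Continuous fun t : ℝ => ((j.1, t • j.2.1, j.2.2) : Jet1) := by fun_prop
    refine eq_zero_of_punctured (f := fun t => fderiv ℝ P (j.1, t • j.2.1, j.2.2) (0, j.2.1, 0))
      (continuousAt_fderiv_curve hU hP hc continuous_const hj) ?_
    filter_upwards [hc.continuousAt.eventually (hU.mem_nhds hj)] with t htU ht0
    exact hne t ht0 htU
  · exact hne t ht hj

/-- If curl p ≠ 0, the jet (x, 0, p) is the limit of the regular jets (x, ε curl p, p), along which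
(ξ, ε curl q, q) is tangent. If curl p = 0, p is first perturbed by a small rotation. -/
theorem fderiv_pressure_singular (hU : IsOpen U) (hP : ContDiffOn ℝ ∞ P U)
    (hX : X.SmoothOn U) (h : ModifiedDetermining U forceFreeSys (plasmaRhs P) X)
    {x ξ : Vec3} {p q : Grad3} (hj : ((x, 0, p) : Jet1) ∈ U) (hp : divL p = 0) (hq : divL q = 0) :
    fderiv ℝ P (x, 0, p) (ξ, 0, q) = 0 := by
  have hne : ∀ p : Grad3, ((x, 0, p) : Jet1) ∈ U → divL p = 0 → curlL p ≠ 0 →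
      fderiv ℝ P (x, 0, p) (ξ, 0, q) = 0 := by
    intro p hj hp hc
    have hcont : Continuous fun ε : ℝ => ((x, ε • curlL p, p) : Jet1) := by fun_prop
    have hcont' : Continuous fun ε : ℝ => ((ξ, ε • curlL q, q) : Jet1) := by fun_prop
    have h0 := eq_zero_of_punctured
      (f := fun ε => fderiv ℝ P (x, ε • curlL p, p) (ξ, ε • curlL q, q))
      (continuousAt_fderiv_curve hU hP hcont hcont' (by simpa using hj)) (by
        filter_upwards [hcont.continuousAt.eventually
          (hU.mem_nhds (x := (x, (0 : ℝ) • curlL p, p)) (by simpa using hj))] with ε hεU hε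
        have h1 : HasDerivAt (fun t : ℝ => x + t • ξ) ξ 0 := by
          simpa using ((hasDerivAt_id (0 : ℝ)).smul_const ξ).const_add x
        have h2 : HasDerivAt (fun t : ℝ => p + t • q) q 0 := by
          simpa using ((hasDerivAt_id (0 : ℝ)).smul_const q).const_add p
        have h3 : HasDerivAt (fun t : ℝ => ε • curlL (p + t • q)) (ε • curlL q) 0 :=
          (curlL.hasFDerivAt.comp_hasDerivAt 0 h2).const_smul ε
        have hεU' : ((x, ε • curlL p, p) : Jet1) ∈ U := hεU
        have h4 := fderiv_pressure_tangent hU hP hX h (h1.prodMk (h3.prodMk h2))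
          (by simpa using hεU') (fun t => forceFreeSys_eq_zero_iff.2
            ⟨by simp only [map_smul]; rw [crossL_apply, cross_self, smul_zero], by simp [hp, hq]⟩)
          (by simpa using ⟨hε, hc⟩)
        simpa using h4)
    simpa using h0
  by_cases hc : curlL p = 0
  · have hcont : Continuous fun ε : ℝ => ((x, 0, p + ε • rot (Pi.single 0 1)) : Jet1) := by
      fun_prop
    have h0 := eq_zero_of_punctured
      (f := fun ε => fderiv ℝ P (x, 0, p + ε • rot (Pi.single 0 1)) (ξ, 0, q))
      (continuousAt_fderiv_curve hU hP hcont continuous_const (by simpa using hj)) (by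
        filter_upwards [hcont.continuousAt.eventually (hU.mem_nhds
          (x := (x, 0, p + (0 : ℝ) • rot (Pi.single 0 1))) (by simpa using hj))] with ε hεU hε
        refine hne _ hεU ?_ fun h' => hε ?_
        · have hrot : divL (rot (Pi.single 0 1)) = 0 := by simp [divL_eq, rot_eq]
          rw [map_add, map_smul, hp, hrot, smul_zero, add_zero]
        · have := congrFun h' 0
          rw [map_add, hc] at this
          simpa [curlL_eq, rot_eq] using this)
    simpa using h0
  · exact hne p hj hp hc

/-- At u = 0 a nearby solution is joined to the centre by two segments inside the variety: shrink u
to 0, then move (x, u₁) with u = 0, where only the linear divergence equation remains. -/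
theorem pressure_eventually_eq (hU : IsOpen U) (hP : ContDiffOn ℝ ∞ P U)
    (hX : X.SmoothOn U) (h : ModifiedDetermining U forceFreeSys (plasmaRhs P) X)
    {j : Jet1} (hj : j ∈ U) (hs : forceFreeSys j = 0) :
    ∀ᶠ j' in nhds j, forceFreeSys j' = 0 → P j' = P j := by
  by_cases hu : j.2.1 = 0
  swap
  · exact pressure_eventually_eq_of_ne_zero hU hP hX h hj hs hu
  obtain ⟨r, hr, hball⟩ := Metric.isOpen_iff.1 hU j hj
  have hdiff : ∀ z ∈ Metric.ball j r, DifferentiableAt ℝ P z := fun z hz =>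
    (hP.contDiffAt (hU.mem_nhds (hball hz))).differentiableAt (by simp)
  filter_upwards [Metric.ball_mem_nhds j hr] with j' hj' hs'
  obtain ⟨x₀, u₀, p₀⟩ := j
  obtain ⟨x, u, p⟩ := j'
  simp only at hu
  subst hu
  have hmem : ((x, 0, p) : Jet1) ∈ Metric.ball (x₀, 0, p₀) r := by
    rw [Metric.mem_ball, Prod.dist_eq, Prod.dist_eq] at hj' ⊢
    simp only [max_lt_iff, dist_self] at hj' ⊢
    exact ⟨hj'.1, hr, hj'.2.2⟩
  have hd := (forceFreeSys_eq_zero_iff.1 hs').2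
  have hd₀ := (forceFreeSys_eq_zero_iff.1 hs).2
  simp only at hd hd₀
  have seg : ∀ {a b : Jet1}, a ∈ Metric.ball (x₀, 0, p₀) r → b ∈ Metric.ball (x₀, 0, p₀) r →
      segment ℝ a b ⊆ Metric.ball (x₀, 0, p₀) r := fun ha hb =>
    (convex_ball _ _).segment_subset ha hb
  have e1 : P (x, 0, p) = P (x, u, p) := by
    refine eq_of_fderiv_apply_sub_eq_zero (convex_segment (x, 0, p) (x, u, p))
      (fun z hz => hdiff z (seg hmem hj' hz)) (left_mem_segment ..) (right_mem_segment ..) ?_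
    intro z hz
    have hz' := hball (seg hmem hj' hz)
    rw [segment_eq_image'] at hz
    obtain ⟨t, -, rfl⟩ := hz
    have h2 : ((x, u, p) - (x, 0, p) : Jet1) = (0, u, 0) := by simp
    have h1 : ((x, 0, p) + t • (0, u, 0) : Jet1) = (x, t • u, p) := by simp
    rw [h2] at hz' ⊢
    beta_reduce at hz' ⊢
    rw [h1] at hz' ⊢
    exact fderiv_pressure_field hU hP hX h hs' t hz'
  have e2 : P (x, 0, p) = P (x₀, 0, p₀) := by
    have hc := Metric.mem_ball_self (x := ((x₀, 0, p₀) : Jet1)) hr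
    refine eq_of_fderiv_apply_sub_eq_zero (convex_segment (x, 0, p) (x₀, 0, p₀))
      (fun z hz => hdiff z (seg hmem hc hz)) (left_mem_segment ..) (right_mem_segment ..) ?_
    intro z hz
    have hz' := hball (seg hmem hc hz)
    rw [segment_eq_image'] at hz
    obtain ⟨t, -, rfl⟩ := hz
    have h2 : ((x₀, 0, p₀) - (x, 0, p) : Jet1) = (x₀ - x, 0, p₀ - p) := by simp
    have h1 : ((x, 0, p) + t • (x₀ - x, 0, p₀ - p) : Jet1) =
        (x + t • (x₀ - x), 0, p + t • (p₀ - p)) := by simp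
    rw [h2] at hz' ⊢
    beta_reduce at hz' ⊢
    rw [h1] at hz' ⊢
    exact fderiv_pressure_singular hU hP hX h hz' (by simp [hd, hd₀]) (by simp [hd, hd₀])
  rw [← e1, e2]

theorem pressure_const_of_isPreconnected (hU : IsOpen U) (hP : ContDiffOn ℝ ∞ P U)
    (hA : AdmissiblePressure U P) {C : Set Jet1} (hCU : C ⊆ U)
    (hC : ∀ j ∈ C, forceFreeSys j = 0) (hconn : IsPreconnected C) : ∃ c : ℝ, ∀ j ∈ C, P j = c := by
  obtain ⟨X, hX, h⟩ := hA
  rcases C.eq_empty_or_nonempty with rfl | ⟨j₀, hj₀⟩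
  · exact ⟨0, fun j hj => absurd hj (Set.notMem_empty j)⟩
  have := isPreconnected_iff_preconnectedSpace.1 hconn
  have hloc : IsLocallyConstant fun j : C => P j := by
    refine (IsLocallyConstant.iff_eventually_eq _).2 fun j => ?_
    filter_upwards [continuous_subtype_val.continuousAt.eventually
      (pressure_eventually_eq hU hP hX h (hCU j.2) (hC j j.2))] with j' hj'
    exact hj' (hC j' j'.2)
  exact ⟨P j₀, fun j hj => hloc.apply_eq_of_preconnectedSpace ⟨j, hj⟩ ⟨j₀, hj₀⟩⟩

end Pressure

/-! ### Connectedness and the zero operator -/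

theorem isPreconnected_forceFree : IsPreconnected {j : Jet1 | forceFreeSys j = 0} := by
  have hstar : StarConvex ℝ (0 : Jet1) {j : Jet1 | forceFreeSys j = 0} := by
    refine starConvex_zero_iff.2 fun j hj t _ _ => ?_
    rw [Set.mem_ofPred_eq, forceFreeSys_eq_zero_iff] at hj ⊢
    simp [hj.1, hj.2]
  have h0 : forceFreeSys (0 : Jet1) = 0 := by
    rw [forceFreeSys_eq_zero_iff]; simp
  exact (hstar.isPathConnected h0).isConnected.isPreconnected

theorem prolong_zero {W : Type*} [NormedAddCommGroup W] [NormedSpace ℝ W] (E : Jet1 → W)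
    (J : Jet2) : InfOp.prolong ⟨fun _ => 0, fun _ => 0⟩ E J = 0 := by
  have h : InfOp.prolongCoeff ⟨fun _ => 0, fun _ => 0⟩ J = 0 := by
    ext k i
    simp [InfOp.prolongCoeff, totalDeriv]
  rw [InfOp.prolong, h]
  exact map_zero _

theorem smoothOn_zero (U : Set Jet1) : InfOp.SmoothOn ⟨fun _ => 0, fun _ => 0⟩ U :=
  ⟨contDiffOn_const, contDiffOn_const⟩

end PlasmaLie

theorem mainTheorem5 :
    -- from vacuum fields to force-free fields: only `α = 0` is admissible
    (∀ U : Set Jet1, IsOpen U →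
      AdmissibleAlpha U (fun _ _ => 0) ∧
      ∀ α : Vec3 → Grad3 → ℝ, ContDiffOn ℝ ∞ (fun j : Jet1 => α j.2.1 j.2.2) U →
        AdmissibleAlpha U α →
        ∀ j ∈ U, vacuumSys j = 0 → α j.2.1 j.2.2 = 0) ∧
    -- from force-free fields to plasma equilibria: only constant `P` is admissible
    (∀ U : Set Jet1, IsOpen U →
      (∀ c : ℝ, AdmissiblePressure U (fun _ => c)) ∧
      ∀ P : Jet1 → ℝ, ContDiffOn ℝ ∞ P U → AdmissiblePressure U P →
        ∀ C : Set Jet1, C ⊆ U → (∀ j ∈ C, forceFreeSys j = 0) → IsPreconnected C →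
          ∃ c : ℝ, ∀ j ∈ C, P j = c) ∧
    -- in particular, over the whole jet space `P` is one constant on all force-free jets
    (∀ P : Jet1 → ℝ, ContDiff ℝ ∞ P → AdmissiblePressure Set.univ P →
      ∃ c : ℝ, ∀ j : Jet1, forceFreeSys j = 0 → P j = c) := by
  refine ⟨fun U hU => ⟨⟨⟨fun _ => 0, fun _ => 0⟩, smoothOn_zero U, fun J _ _ => ?_⟩, ?_⟩,
    fun U hU => ⟨fun c => ⟨⟨fun _ => 0, fun _ => 0⟩, smoothOn_zero U, fun J _ _ => ?_⟩, ?_⟩, ?_⟩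
  · rw [prolong_zero, forceFreeRhs, zero_smul]; rfl
  · rintro α hα ⟨X, hX, h⟩ j hj hs
    exact alpha_eq_zero hU hα hX h hj hs
  · rw [prolong_zero, plasmaRhs]
    ext <;> simp [totalDeriv]
  · intro P hP hA C hCU hC hconn
    exact pressure_const_of_isPreconnected hU hP hA hCU hC hconn
  · intro P hP hA
    obtain ⟨c, hc⟩ := pressure_const_of_isPreconnected isOpen_univ hP.contDiffOn hA
      (Set.subset_univ _) (fun j hj => hj) isPreconnected_forceFree
    exact ⟨c, fun j hj => hc j hj⟩
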